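/- **Setting.** All operator spaces are complex. Let $\mathfrak A$ be a completely contractive dual Banach algebra with predual $\mathfrak A_*$: $\mathfrak A$ is a (not necessarily unital) Banach algebra that, as an operator space, is the dual of a complete operator space $\mathfrak A_*$; its multiplication is a (jointly) completely bounded, for instance completely contractive, bilinear map; and the multiplication is separately $w^*$-continuous. Then $\mathfrak A_*$ is an $\mathfrak A$-bimodule by $\langle b, a\cdot f\rangle=\langle ba,f\rangle$ and $\langle b, f\cdot a\rangle=\langle ab,f\rangle$. For matrices $a=(a_{i,j})$ and $x=(x_{k,l})$ put $a\star x=(a_{i,j}\cdot x_{k,l})$. Let $n\ge 1$, let $\phi=(\phi_{i,j})\in M_n(\mathfrak A_*)$, put $a\cdot\phi=(a\cdot\phi_{i,j})$ and $\mathfrak A\cdot\phi=\{a\cdot\phi : a\in\mathfrak A\}$. An *admissible operator norm* for $\phi$ is a family of norms $\|\cdot\|_{\phi,m}$ on $M_m(\mathfrak A\cdot\phi)$, $m\ge 1$, that satisfies Ruan's axioms, such that $$\|a\star b\|_{\phi,mk}\le\|a\|_m\|b\|_{\phi,k},\qquad \|a\star\phi\|_{mn}\le\|a\star\phi\|_{\phi,m}\le\|a\|_m\|\phi\|_n$$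 for all $m,k\ge 1$, $a\in M_m(\mathfrak A)$ and $b\in M_k(\mathfrak A\cdot\phi)$, and such that the completion $E_\phi$ of $(\mathfrak A\cdot\phi,\|\cdot\|_{\phi,1})$, with the extended matrix norms, is reflexive and the continuous extension $\iota_\phi:E_\phi\to M_n(\mathfrak A_*)$ of the inclusion is injective. For $c\in M_n(\mathfrak A)$ let $\iota_\phi^*(c)\in E_\phi^*$ be the functional $x\mapsto\sum_{i,j}\langle c_{i,j},\iota_\phi(x)_{i,j}\rangle$. Let $\hat\otimes$ be the projective tensor product of operator spaces, and give $CB(E_\phi)$ the $w^*$-topology of the duality with $E_\phi^*\hat\otimes E_\phi$ determined by $\langle T,f\otimes x\rangle=f(Tx)$. **Theorem 1.** Let $\mathfrak A$ be a completely contractive dual Banach algebra, and let $\phi\in M_n(\mathfrak A_*)$, $n\ge1$, have an admissible operator norm. Then there is exactly one bounded linear map $S_\phi:E_\phi^*\hat\otimes E_\phi\to\mathfrak A_*$ with $$S_\phi\big(\iota_\phi^*(c)\otimes a\cdot\phi\big)=\sum_{i,j=1}^n a\cdot\phi_{i,j}\cdot c_{i,j}\qquad(c\in M_n(\mathfrak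 A),\ a\in\mathfrak A),$$ and its adjoint $T_\phi=S_\phi^*$, that is, $\langle T_\phi(a),u\rangle=\langle a,S_\phi(u)\rangle$ for $a\in\mathfrak A$ and $u\in E_\phi^*\hat\otimes E_\phi$, is a $w^*$-continuous, completely contractive, multiplicative linear representation $T_\phi:\mathfrak A\to CB(E_\phi)$. It extends the module action: $T_\phi(a)(b\cdot\phi)=(ab)\cdot\phi$ for all $a,b\in\mathfrak A$. -/

import Mathlib

open scoped ENNReal TensorProduct Topology

set_option linter.unusedSectionVars false

noncomputable section

/-- The operator norm of a rectangular scalar matrix, acting between Euclidean spaces. -/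
def scalarNorm {m n : ℕ} (α : Matrix (Fin m) (Fin n) ℂ) : ℝ :=
  ‖(Matrix.toEuclideanLin α).toContinuousLinearMap‖

/-- The product `α x β` of a matrix `x` over a vector space with scalar matrices `α`, `β`. -/
def sandwich {V : Type*} [AddCommGroup V] [Module ℂ V] {m n : ℕ}
    (α : Matrix (Fin m) (Fin n) ℂ) (x : Matrix (Fin n) (Fin n) V)
    (β : Matrix (Fin n) (Fin m) ℂ) : Matrix (Fin m) (Fin m) V :=
  Matrix.of fun i j => ∑ s, ∑ t, (α i s * β t j) • x s t

/-- The block diagonal matrix with blocks `x` and `y`. -/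
def oplus {V : Type*} [Zero V] {m n : ℕ} (x : Matrix (Fin m) (Fin m) V)
    (y : Matrix (Fin n) (Fin n) V) : Matrix (Fin (m + n)) (Fin (m + n)) V :=
  Matrix.reindex finSumFinEquiv finSumFinEquiv (Matrix.fromBlocks x 0 0 y)

/-- The `(m, k)`-amplification of a map `B` of two variables: the matrix
`(B (x i j) (y k l))`, whose rows are indexed by the pairs `(i, k)` and whose columns are
indexed by the pairs `(j, l)`. -/
def bilinAmp {X Y Z : Type*} {m k : ℕ} (B : X → Y → Z) (x : Matrix (Fin m) (Fin m) X)
    (y : Matrix (Fin k) (Fin k) Y) : Matrix (Fin (m * k)) (Fin (m * k)) Z :=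
  Matrix.reindex finProdFinEquiv finProdFinEquiv (Matrix.kroneckerMap B x y)

/-- A matricial norm on a complex vector space: a norm on the `n × n` matrices for every `n`,
subject to Ruan's two axioms. The second one is stated for rectangular `α` and `β`; given the first,
this is equivalent to the case of square matrices. -/
structure MatricialNorm (V : Type*) [AddCommGroup V] [Module ℂ V] where
  matNorm : ∀ {n : ℕ}, Matrix (Fin n) (Fin n) V → ℝ
  matNorm_add_le : ∀ {n : ℕ} (x y : Matrix (Fin n) (Fin n) V),
    matNorm (x + y) ≤ matNorm x + matNorm y
  matNorm_smul : ∀ {n : ℕ} (c : ℂ) (x : Matrix (Fin n) (Fin n) V),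
    matNorm (c • x) = ‖c‖ * matNorm x
  eq_zero_of_matNorm : ∀ {n : ℕ} (x : Matrix (Fin n) (Fin n) V), matNorm x = 0 → x = 0
  matNorm_oplus : ∀ {m n : ℕ} (x : Matrix (Fin m) (Fin m) V) (y : Matrix (Fin n) (Fin n) V),
    matNorm (oplus x y) = max (matNorm x) (matNorm y)
  matNorm_sandwich_le : ∀ {m n : ℕ} (α : Matrix (Fin m) (Fin n) ℂ)
    (x : Matrix (Fin n) (Fin n) V) (β : Matrix (Fin n) (Fin m) ℂ),
    matNorm (sandwich α x β) ≤ scalarNorm α * matNorm x * scalarNorm β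

/-- An operator space structure on a normed space: a matricial norm that at level one is the
given norm. (Completeness is a separate hypothesis, `CompleteSpace E`.) -/
class OperatorSpace (E : Type*) [NormedAddCommGroup E] [NormedSpace ℂ E] extends
    MatricialNorm E where
  matNorm_one : ∀ x : E, matNorm !![x] = ‖x‖


section Scalars

open scoped Matrix.Norms.L2Operator

lemma scalarNorm_eq {m n : ℕ} (α : Matrix (Fin m) (Fin n) ℂ) : scalarNorm α = ‖α‖ := rfl

lemma sandwich_eq_mul {m n : ℕ} (α : Matrix (Fin m) (Fin n) ℂ) (x : Matrix (Fin n) (Fin n) ℂ)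
    (β : Matrix (Fin n) (Fin m) ℂ) : sandwich α x β = α * x * β := by
  ext i j
  simp only [sandwich, Matrix.of_apply, Matrix.mul_apply, smul_eq_mul, Finset.sum_mul]
  rw [Finset.sum_comm]
  refine Finset.sum_congr rfl fun _ _ => Finset.sum_congr rfl fun _ _ => by ring

/-- The norm of a scalar matrix is bounded by any bound in terms of Euclidean norms. -/
lemma scalarNorm_le {m n : ℕ} (α : Matrix (Fin m) (Fin n) ℂ) (C : ℝ) (hC : 0 ≤ C)
    (h : ∀ ξ : Fin n → ℂ, ∑ i, ‖∑ j, α i j * ξ j‖ ^ 2 ≤ C ^ 2 * ∑ j, ‖ξ j‖ ^ 2) :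
    scalarNorm α ≤ C := by
  refine ContinuousLinearMap.opNorm_le_bound _ hC fun ξ => ?_
  refine (sq_le_sq₀ (norm_nonneg _) (by positivity)).mp ?_
  rw [mul_pow, EuclideanSpace.norm_sq_eq, EuclideanSpace.norm_sq_eq]
  exact h ξ.ofLp

lemma scalarNorm_apply_le {m n : ℕ} (α : Matrix (Fin m) (Fin n) ℂ) (ξ : Fin n → ℂ) :
    ∑ i, ‖∑ j, α i j * ξ j‖ ^ 2 ≤ scalarNorm α ^ 2 * ∑ j, ‖ξ j‖ ^ 2 := by
  have := (Matrix.toEuclideanLin α).toContinuousLinearMap.le_opNorm (WithLp.toLp 2 ξ)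
  have := (sq_le_sq₀ (norm_nonneg _) (by positivity)).mpr this
  rw [mul_pow, EuclideanSpace.norm_sq_eq, EuclideanSpace.norm_sq_eq] at this
  exact this

lemma scalarNorm_nonneg {m n : ℕ} (α : Matrix (Fin m) (Fin n) ℂ) : 0 ≤ scalarNorm α :=
  norm_nonneg _

/-- The scalar matrix selecting the coordinates `f i`. -/
def selMat {m n : ℕ} (f : Fin m → Fin n) : Matrix (Fin m) (Fin n) ℂ :=
  Matrix.of fun i s => if s = f i then 1 else 0

lemma scalarNorm_selMat {m n : ℕ} (f : Fin m → Fin n) (hf : Function.Injective f) :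
    scalarNorm (selMat f) ≤ 1 := by
  refine scalarNorm_le _ 1 zero_le_one fun ξ => ?_
  simp only [selMat, Matrix.of_apply, ite_mul, one_mul, zero_mul, Finset.sum_ite_eq',
    Finset.mem_univ, if_true, one_pow]
  rw [← Finset.sum_image (f := fun j => ‖ξ j‖ ^ 2) (g := f) (s := Finset.univ)
    (fun a _ b _ h => hf h)]
  exact Finset.sum_le_sum_of_subset_of_nonneg (Finset.subset_univ _) fun _ _ _ => by positivity

lemma scalarNorm_selMat_transpose {m n : ℕ} (f : Fin m → Fin n) (hf : Function.Injective f) :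
    scalarNorm (selMat f).transpose ≤ 1 := by
  have : (selMat f).transpose = (selMat f).conjTranspose := by
    ext i j
    simp only [selMat, Matrix.transpose_apply, Matrix.conjTranspose_apply, Matrix.of_apply]
    split_ifs <;> simp
  rw [this, scalarNorm_eq, Matrix.l2_opNorm_conjTranspose]
  exact scalarNorm_selMat f hf

lemma sandwich_selMat {V : Type*} [AddCommGroup V] [Module ℂ V] {m n : ℕ}
    (f g : Fin m → Fin n) (x : Matrix (Fin n) (Fin n) V) :
    sandwich (selMat f) x (selMat g).transpose = x.submatrix f g := by
  ext i j
  simp [sandwich, selMat, Matrix.submatrix_apply]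

/-- Tensoring a scalar matrix with an identity matrix. -/
def ampScalar {m n : ℕ} (k : ℕ) (α : Matrix (Fin m) (Fin n) ℂ) :
    Matrix (Fin (m * k)) (Fin (n * k)) ℂ :=
  Matrix.reindex finProdFinEquiv finProdFinEquiv
    (Matrix.kroneckerMap (· * ·) α (1 : Matrix (Fin k) (Fin k) ℂ))

lemma scalarNorm_ampScalar {m n : ℕ} (k : ℕ) (α : Matrix (Fin m) (Fin n) ℂ) :
    scalarNorm (ampScalar k α) ≤ scalarNorm α := by
  refine scalarNorm_le _ _ (scalarNorm_nonneg _) fun ξ => ?_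
  rw [← finProdFinEquiv.sum_comp, ← finProdFinEquiv.sum_comp (fun j => ‖ξ j‖ ^ 2)]
  simp only [← finProdFinEquiv.sum_comp (fun j => ampScalar k α _ j * ξ j)]
  simp only [Fintype.sum_prod_type, ampScalar, Matrix.reindex_apply, Matrix.submatrix_apply,
    Equiv.symm_apply_apply, Matrix.kroneckerMap_apply, Matrix.one_apply, mul_ite, mul_one,
    mul_zero, ite_mul, zero_mul, Finset.sum_ite_eq, Finset.mem_univ, if_true]
  rw [Finset.sum_comm, Finset.sum_comm (f := fun (x : Fin n) (y : Fin k) => ‖ξ (finProdFinEquiv (x, y))‖ ^ 2),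
    Finset.mul_sum]
  exact Finset.sum_le_sum fun l _ => scalarNorm_apply_le α fun j => ξ (finProdFinEquiv (j, l))

end Scalars

namespace MatricialNorm

variable {V : Type*} [AddCommGroup V] [Module ℂ V] (N : MatricialNorm V)

lemma matNorm_zero {n : ℕ} : N.matNorm (0 : Matrix (Fin n) (Fin n) V) = 0 := by
  have := N.matNorm_smul 0 (0 : Matrix (Fin n) (Fin n) V)
  simpa using this

lemma matNorm_neg {n : ℕ} (x : Matrix (Fin n) (Fin n) V) : N.matNorm (-x) = N.matNorm x := by
  have := N.matNorm_smul (-1) x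
  simpa using this

lemma matNorm_nonneg {n : ℕ} (x : Matrix (Fin n) (Fin n) V) : 0 ≤ N.matNorm x := by
  have h := N.matNorm_add_le x (-x)
  rw [add_neg_cancel, matNorm_zero, matNorm_neg] at h
  linarith

lemma matNorm_submatrix_le {m n : ℕ} (f g : Fin m → Fin n) (hf : Function.Injective f)
    (hg : Function.Injective g) (x : Matrix (Fin n) (Fin n) V) :
    N.matNorm (x.submatrix f g) ≤ N.matNorm x := by
  rw [← sandwich_selMat]
  refine (N.matNorm_sandwich_le _ _ _).trans ?_
  have h1 := scalarNorm_selMat f hf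
  have h2 := scalarNorm_selMat_transpose g hg
  have h3 := N.matNorm_nonneg x
  have h4 := scalarNorm_nonneg (selMat f)
  have h5 := scalarNorm_nonneg (selMat g).transpose
  calc _ ≤ (1 * N.matNorm x) * 1 := by gcongr
    _ = _ := by ring

lemma matNorm_submatrix_equiv {m n : ℕ} (e : Fin m ≃ Fin n) (x : Matrix (Fin n) (Fin n) V) :
    N.matNorm (x.submatrix e e) = N.matNorm x := by
  refine le_antisymm (N.matNorm_submatrix_le _ _ e.injective e.injective x) ?_
  have := N.matNorm_submatrix_le _ _ e.symm.injective e.symm.injective (x.submatrix e e)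
  simpa using this

lemma matNorm_sum_le {n : ℕ} {ι : Type*} (s : Finset ι) (x : ι → Matrix (Fin n) (Fin n) V) :
    N.matNorm (∑ i ∈ s, x i) ≤ ∑ i ∈ s, N.matNorm (x i) := by
  classical
  induction s using Finset.induction_on with
  | empty => simp [matNorm_zero]
  | insert a s ha ih =>
    rw [Finset.sum_insert ha, Finset.sum_insert ha]
    exact (N.matNorm_add_le _ _).trans (by gcongr)

/-- Every entry is bounded by the norm of the matrix. -/
lemma matNorm_entry_le {n : ℕ} (x : Matrix (Fin n) (Fin n) V) (i j : Fin n) :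
    N.matNorm !![x i j] ≤ N.matNorm x := by
  have := N.matNorm_submatrix_le (fun _ : Fin 1 => i) (fun _ => j)
    (fun _ _ _ => Subsingleton.elim _ _) (fun _ _ _ => Subsingleton.elim _ _) x
  convert this using 2
  ext a b
  simp

lemma matNorm_single_le {n : ℕ} (i j : Fin n) (v : V) :
    N.matNorm (Matrix.single i j v) ≤ N.matNorm !![v] := by
  have h := N.matNorm_sandwich_le (selMat (fun _ : Fin 1 => i)).transpose !![v]
    (selMat (fun _ : Fin 1 => j))
  have e : sandwich (selMat (fun _ : Fin 1 => i)).transpose !![v] (selMat (fun _ : Fin 1 => j))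
      = Matrix.single i j v := by
    ext a b
    have h3 : (a = i) = (i = a) := propext eq_comm
    have h4 : (b = j) = (j = b) := propext eq_comm
    by_cases h1 : i = a <;> by_cases h2 : j = b <;>
      simp [sandwich, selMat, h1, h2, h3, h4]
  rw [e] at h
  refine h.trans ?_
  have h1 := scalarNorm_selMat_transpose (fun _ : Fin 1 => i)
    (fun _ _ _ => Subsingleton.elim _ _)
  have h2 := scalarNorm_selMat (fun _ : Fin 1 => j) (fun _ _ _ => Subsingleton.elim _ _)
  have h3 := N.matNorm_nonneg !![v]
  have h4 := scalarNorm_nonneg (selMat (fun _ : Fin 1 => i)).transpose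
  have h5 := scalarNorm_nonneg (selMat (fun _ : Fin 1 => j))
  calc _ ≤ (1 * N.matNorm !![v]) * 1 := by gcongr
    _ = _ := by ring

lemma matNorm_le_sum {n : ℕ} (x : Matrix (Fin n) (Fin n) V) :
    N.matNorm x ≤ ∑ i, ∑ j, N.matNorm !![x i j] := by
  conv_lhs => rw [Matrix.matrix_eq_sum_single x]
  refine (N.matNorm_sum_le _ _).trans (Finset.sum_le_sum fun i _ => ?_)
  refine (N.matNorm_sum_le _ _).trans (Finset.sum_le_sum fun j _ => N.matNorm_single_le i j _)

/-- The vector space underlying a matricial norm, normed by the norm at level one. -/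
def Space (_ : MatricialNorm V) : Type _ := V

instance : AddCommGroup N.Space := inferInstanceAs (AddCommGroup V)

instance : Module ℂ N.Space := inferInstanceAs (Module ℂ V)

/-- The identity map from the vector space to its normed version. -/
def toSpace : V ≃ₗ[ℂ] N.Space := LinearEquiv.refl ℂ V

instance : Norm N.Space := ⟨fun v => N.matNorm !![N.toSpace.symm v]⟩

lemma space_norm_def (v : N.Space) : ‖v‖ = N.matNorm !![N.toSpace.symm v] := rfl

lemma space_core : NormedSpace.Core ℂ N.Space where
  norm_nonneg v := N.matNorm_nonneg _
  norm_smul c v := by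
    rw [space_norm_def, space_norm_def, ← N.matNorm_smul, map_smul]
    congr 1
    ext i j
    simp [Subsingleton.elim i 0, Subsingleton.elim j 0]
  norm_triangle v w := by
    rw [space_norm_def, space_norm_def, space_norm_def, map_add]
    convert N.matNorm_add_le !![N.toSpace.symm v] !![N.toSpace.symm w] using 2
    ext i j
    simp [Subsingleton.elim i 0, Subsingleton.elim j 0]
  norm_eq_zero_iff v := by
    constructor
    · intro h
      have := congrFun (congrFun (N.eq_zero_of_matNorm _ h) 0) 0
      simpa using this
    · rintro rfl
      rw [space_norm_def, map_zero]
      convert N.matNorm_zero (n := 1)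
      ext i j
      simp [Subsingleton.elim i 0, Subsingleton.elim j 0]

instance : NormedAddCommGroup N.Space := NormedAddCommGroup.ofCore N.space_core

instance : NormedSpace ℂ N.Space := NormedSpace.ofCore N.space_core

instance : OperatorSpace N.Space where
  toMatricialNorm := N
  matNorm_one _ := rfl

end MatricialNorm

/-- The norm of a matrix over an operator space. -/
def matNorm {E : Type*} [NormedAddCommGroup E] [NormedSpace ℂ E] [OperatorSpace E] {n : ℕ}
    (x : Matrix (Fin n) (Fin n) E) : ℝ :=
  (OperatorSpace.toMatricialNorm (E := E)).matNorm x

section OperatorSpaceLemmas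

variable {E : Type*} [NormedAddCommGroup E] [NormedSpace ℂ E] [OperatorSpace E]

lemma matNorm_one (x : E) : matNorm !![x] = ‖x‖ := OperatorSpace.matNorm_one x

lemma matNorm_nonneg {n : ℕ} (x : Matrix (Fin n) (Fin n) E) : 0 ≤ matNorm x :=
  MatricialNorm.matNorm_nonneg _ x

lemma norm_entry_le {n : ℕ} (x : Matrix (Fin n) (Fin n) E) (i j : Fin n) :
    ‖x i j‖ ≤ matNorm x := by
  rw [← matNorm_one]
  exact MatricialNorm.matNorm_entry_le _ x i j

lemma matNorm_le_sum {n : ℕ} (x : Matrix (Fin n) (Fin n) E) :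
    matNorm x ≤ ∑ i, ∑ j, ‖x i j‖ := by
  simp only [← matNorm_one]
  exact MatricialNorm.matNorm_le_sum _ x

lemma matNorm_smul {n : ℕ} (c : ℂ) (x : Matrix (Fin n) (Fin n) E) :
    matNorm (c • x) = ‖c‖ * matNorm x := MatricialNorm.matNorm_smul _ c x

lemma matNorm_add_le {n : ℕ} (x y : Matrix (Fin n) (Fin n) E) :
    matNorm (x + y) ≤ matNorm x + matNorm y := MatricialNorm.matNorm_add_le _ x y

lemma abs_matNorm_sub_le {n : ℕ} (x y : Matrix (Fin n) (Fin n) E) :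
    |matNorm x - matNorm y| ≤ matNorm (x - y) := by
  have h1 := matNorm_add_le (x - y) y
  have h2 := matNorm_add_le (y - x) x
  have h3 : matNorm (y - x) = matNorm (x - y) := by
    rw [← neg_sub x y]; exact MatricialNorm.matNorm_neg _ _
  simp only [sub_add_cancel] at h1 h2
  rw [abs_le]; constructor <;> linarith

lemma eq_zero_of_matNorm {n : ℕ} (x : Matrix (Fin n) (Fin n) E) (h : matNorm x = 0) : x = 0 :=
  MatricialNorm.eq_zero_of_matNorm _ x h

lemma uniformContinuous_matNorm {n : ℕ} :
    UniformContinuous (fun x : Matrix (Fin n) (Fin n) E => matNorm x) := by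
  have : UniformContinuous (fun x : Fin n → Fin n → E => matNorm (E := E) (Matrix.of x)) := by
    refine (LipschitzWith.of_dist_le_mul (K := n * n) fun x y => ?_).uniformContinuous
    rw [Real.dist_eq]
    refine (abs_matNorm_sub_le _ _).trans ((matNorm_le_sum _).trans ?_)
    calc ∑ i, ∑ j, ‖(Matrix.of x - Matrix.of y) i j‖ ≤ ∑ i : Fin n, ∑ j : Fin n, dist x y := by
          refine Finset.sum_le_sum fun i _ => Finset.sum_le_sum fun j _ => ?_
          rw [Matrix.sub_apply, Matrix.of_apply, Matrix.of_apply, ← dist_eq_norm]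
          exact (dist_le_pi_dist (x i) (y i) j).trans (dist_le_pi_dist x y i)
      _ = _ := by simp [mul_assoc]
  exact this

end OperatorSpaceLemmas

section Completion

open UniformSpace

variable {E : Type*} [NormedAddCommGroup E] [NormedSpace ℂ E] [OperatorSpace E]

/-- The entrywise inclusion of the matrices over `E` in those over the completion of `E`. -/
def matCoe {n : ℕ} (x : Matrix (Fin n) (Fin n) E) : Matrix (Fin n) (Fin n) (Completion E) :=
  x.map (fun v => (v : Completion E))

lemma isUniformInducing_matCoe {n : ℕ} : IsUniformInducing (matCoe (E := E) (n := n)) := by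
  have h : Isometry (fun (x : Fin n → Fin n → E) => fun i j => (x i j : Completion E)) :=
    Isometry.piMap (fun _ (y : Fin n → E) => fun j => (y j : Completion E))
      fun _ => Isometry.piMap (fun _ (y : E) => (y : Completion E))
        fun _ => Completion.coe_isometry
  exact h.isUniformInducing

lemma denseRange_matCoe {n : ℕ} : DenseRange (matCoe (E := E) (n := n)) := by
  have h : DenseRange (Pi.map fun (_ : Fin n) => Pi.map fun (_ : Fin n) (y : E) =>
      (y : Completion E)) :=
    DenseRange.piMap fun _ => DenseRange.piMap fun _ => Completion.denseRange_coe
  exact h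

lemma isDenseInducing_matCoe {n : ℕ} : IsDenseInducing (matCoe (E := E) (n := n)) :=
  isUniformInducing_matCoe.isDenseInducing denseRange_matCoe

/-- The norms on the matrices over the completion: the continuous extensions of the norms on the
matrices over `E`. -/
def complMatNorm {n : ℕ} : Matrix (Fin n) (Fin n) (Completion E) → ℝ :=
  isDenseInducing_matCoe.extend (fun x : Matrix (Fin n) (Fin n) E => matNorm x)

lemma complMatNorm_coe {n : ℕ} (x : Matrix (Fin n) (Fin n) E) :
    complMatNorm (matCoe x) = matNorm x :=
  uniformly_extend_of_ind isUniformInducing_matCoe denseRange_matCoe uniformContinuous_matNorm x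

lemma continuous_complMatNorm {n : ℕ} : Continuous (complMatNorm (E := E) (n := n)) :=
  (uniformContinuous_uniformly_extend isUniformInducing_matCoe denseRange_matCoe
    uniformContinuous_matNorm).continuous

lemma matCoe_add {n : ℕ} (x y : Matrix (Fin n) (Fin n) E) :
    matCoe (x + y) = matCoe x + matCoe y := by
  ext i j; simp [matCoe, Completion.coe_add]

lemma matCoe_smul {n : ℕ} (c : ℂ) (x : Matrix (Fin n) (Fin n) E) :
    matCoe (c • x) = c • matCoe x := by
  ext i j; simp [matCoe]

lemma matCoe_oplus {m n : ℕ} (x : Matrix (Fin m) (Fin m) E) (y : Matrix (Fin n) (Fin n) E) :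
    matCoe (oplus x y) = oplus (matCoe x) (matCoe y) := by
  ext i j
  simp only [matCoe, oplus, Matrix.reindex_apply, Matrix.submatrix_apply, Matrix.map_apply]
  rcases finSumFinEquiv.symm i with i | i <;> rcases finSumFinEquiv.symm j with j | j <;> simp

lemma matCoe_sandwich {m n : ℕ} (α : Matrix (Fin m) (Fin n) ℂ) (x : Matrix (Fin n) (Fin n) E)
    (β : Matrix (Fin n) (Fin m) ℂ) :
    matCoe (sandwich α x β) = sandwich α (matCoe x) β := by
  ext i j
  simp only [matCoe, sandwich, Matrix.map_apply, Matrix.of_apply]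
  rw [← Completion.coe_toComplL (𝕜 := ℂ)]
  simp only [map_sum, map_smul]

lemma continuous_oplus {m n : ℕ} {F : Type*} [TopologicalSpace F] [Zero F] :
    Continuous (fun p : Matrix (Fin m) (Fin m) F × Matrix (Fin n) (Fin n) F =>
      oplus p.1 p.2) :=
  (Continuous.matrix_fromBlocks continuous_fst continuous_const continuous_const
    continuous_snd).matrix_reindex _ _

lemma continuous_sandwich {m n : ℕ} {F : Type*} [NormedAddCommGroup F] [NormedSpace ℂ F]
    (α : Matrix (Fin m) (Fin n) ℂ) (β : Matrix (Fin n) (Fin m) ℂ) :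
    Continuous (fun x : Matrix (Fin n) (Fin n) F => sandwich α x β) := by
  refine continuous_matrix fun i j => ?_
  simp only [sandwich, Matrix.of_apply]
  exact continuous_finsetSum _ fun s _ => continuous_finsetSum _ fun t _ =>
    (continuous_id.matrix_elem s t).const_smul _

lemma norm_entry_le_complMatNorm {n : ℕ} (x : Matrix (Fin n) (Fin n) (Completion E))
    (i j : Fin n) : ‖x i j‖ ≤ complMatNorm x := by
  have hc : Continuous fun x : Matrix (Fin n) (Fin n) (Completion E) => ‖x i j‖ :=
    continuous_norm.comp (Continuous.matrix_elem continuous_id i j)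
  refine isClosed_property denseRange_matCoe (p := fun x => ‖x i j‖ ≤ complMatNorm x)
    (isClosed_le hc continuous_complMatNorm) (fun y => ?_) x
  rw [complMatNorm_coe]
  simpa [matCoe] using norm_entry_le y i j

instance : OperatorSpace (Completion E) where
  matNorm := complMatNorm
  matNorm_add_le x y := by
    refine isClosed_property2 denseRange_matCoe
      (p := fun x y => complMatNorm (x + y) ≤ complMatNorm x + complMatNorm y)
      (isClosed_le (continuous_complMatNorm.comp continuous_add)
        ((continuous_complMatNorm.comp continuous_fst).add
          (continuous_complMatNorm.comp continuous_snd))) (fun x y => ?_) x y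
    rw [← matCoe_add, complMatNorm_coe, complMatNorm_coe, complMatNorm_coe]
    exact matNorm_add_le x y
  matNorm_smul c x := by
    refine isClosed_property denseRange_matCoe
      (p := fun x => complMatNorm (c • x) = ‖c‖ * complMatNorm x)
      (isClosed_eq (continuous_complMatNorm.comp (continuous_const_smul c))
        (continuous_const.mul continuous_complMatNorm)) (fun x => ?_) x
    rw [← matCoe_smul, complMatNorm_coe, complMatNorm_coe]
    exact matNorm_smul c x
  eq_zero_of_matNorm x h := by
    ext i j
    have := norm_entry_le_complMatNorm x i j
    rw [h] at this
    simpa using this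
  matNorm_oplus {m n} x y := by
    refine isClosed_property (denseRange_matCoe.prodMap denseRange_matCoe)
      (p := fun p : Matrix (Fin m) (Fin m) (Completion E) × Matrix (Fin n) (Fin n) (Completion E)
        => complMatNorm (oplus p.1 p.2) = max (complMatNorm p.1) (complMatNorm p.2))
      (isClosed_eq (continuous_complMatNorm.comp continuous_oplus)
        ((continuous_complMatNorm.comp continuous_fst).max
          (continuous_complMatNorm.comp continuous_snd))) (fun p => ?_) (x, y)
    simp only [Prod.map_fst, Prod.map_snd]
    rw [← matCoe_oplus, complMatNorm_coe, complMatNorm_coe, complMatNorm_coe]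
    exact MatricialNorm.matNorm_oplus _ p.1 p.2
  matNorm_sandwich_le α x β := by
    refine isClosed_property denseRange_matCoe
      (p := fun x => complMatNorm (sandwich α x β) ≤
        scalarNorm α * complMatNorm x * scalarNorm β)
      (isClosed_le (continuous_complMatNorm.comp (continuous_sandwich α β))
        ((continuous_const.mul continuous_complMatNorm).mul continuous_const)) (fun x => ?_) x
    rw [← matCoe_sandwich, complMatNorm_coe, complMatNorm_coe]
    exact MatricialNorm.matNorm_sandwich_le _ α x β
  matNorm_one x := by
    refine isClosed_property Completion.denseRange_coe
      (p := fun x => complMatNorm !![x] = ‖x‖)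
      (isClosed_eq (continuous_complMatNorm.comp (continuous_matrix fun i j => ?_))
        continuous_norm) (fun x => ?_) x
    · simpa [Subsingleton.elim i 0, Subsingleton.elim j 0] using! continuous_id
    · have : !![(x : Completion E)] = matCoe !![x] := by
        ext i j; simp [matCoe, Subsingleton.elim i 0, Subsingleton.elim j 0]
      rw [this, complMatNorm_coe, matNorm_one, Completion.norm_coe]

end Completion

section ScalarOperatorSpace

open scoped Matrix.Norms.L2Operator

lemma norm_oplus_scalar {m n : ℕ} (x : Matrix (Fin m) (Fin m) ℂ) (y : Matrix (Fin n) (Fin n) ℂ) :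
    scalarNorm (oplus x y) = max (scalarNorm x) (scalarNorm y) := by
  have sub : ∀ {k l : ℕ} (f : Fin k → Fin l) (_ : Function.Injective f)
      (z : Matrix (Fin l) (Fin l) ℂ), scalarNorm (z.submatrix f f) ≤ scalarNorm z := by
    intro k l f hf z
    rw [← sandwich_selMat, sandwich_eq_mul]
    have h1 := scalarNorm_selMat f hf
    have h2 := scalarNorm_selMat_transpose f hf
    have h3 := scalarNorm_nonneg z
    have h4 := scalarNorm_nonneg (selMat f)
    have h5 := scalarNorm_nonneg (selMat f).transpose
    rw [scalarNorm_eq] at *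
    calc ‖selMat f * z * (selMat f).transpose‖
        ≤ ‖selMat f‖ * ‖z‖ * ‖(selMat f).transpose‖ :=
          (Matrix.l2_opNorm_mul _ _).trans (by gcongr; exact Matrix.l2_opNorm_mul _ _)
      _ ≤ (1 * ‖z‖) * 1 := by gcongr
      _ = ‖z‖ := by ring
  refine le_antisymm ?_ (max_le ?_ ?_)
  · refine scalarNorm_le _ _ (le_max_of_le_left (scalarNorm_nonneg x)) fun ξ => ?_
    rw [← finSumFinEquiv.sum_comp, ← finSumFinEquiv.sum_comp (fun j => ‖ξ j‖ ^ 2)]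
    simp only [← finSumFinEquiv.sum_comp (fun j => oplus x y _ j * ξ j)]
    simp only [oplus, Fintype.sum_sum_type, Matrix.reindex_apply, Matrix.submatrix_apply,
      Equiv.symm_apply_apply, Matrix.fromBlocks_apply₁₁, Matrix.fromBlocks_apply₁₂,
      Matrix.fromBlocks_apply₂₁, Matrix.fromBlocks_apply₂₂, Matrix.zero_apply, zero_mul,
      Finset.sum_const_zero, add_zero, zero_add, mul_add]
    have hx := scalarNorm_apply_le x fun j => ξ (finSumFinEquiv (Sum.inl j))
    have hy := scalarNorm_apply_le y fun j => ξ (finSumFinEquiv (Sum.inr j))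
    have h1 := scalarNorm_nonneg x
    have h2 := scalarNorm_nonneg y
    refine add_le_add (hx.trans ?_) (hy.trans ?_)
    · gcongr
      exact le_max_left _ _
    · gcongr
      exact le_max_right _ _
  · have h := sub (fun i : Fin m => finSumFinEquiv (Sum.inl i))
      (finSumFinEquiv.injective.comp Sum.inl_injective) (oplus x y)
    refine le_trans (le_of_eq (congrArg scalarNorm (Matrix.ext fun i j => ?_))) h
    simp only [oplus, Matrix.reindex_apply, Matrix.submatrix_apply, Equiv.symm_apply_apply,
      Matrix.fromBlocks_apply₁₁]
  · have h := sub (fun i : Fin n => finSumFinEquiv (Sum.inr i))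
      (finSumFinEquiv.injective.comp Sum.inr_injective) (oplus x y)
    refine le_trans (le_of_eq (congrArg scalarNorm (Matrix.ext fun i j => ?_))) h
    simp only [oplus, Matrix.reindex_apply, Matrix.submatrix_apply, Equiv.symm_apply_apply,
      Matrix.fromBlocks_apply₂₂]

/-- The complex numbers as an operator space: `M_n(ℂ)` carries the operator norm. -/
instance : OperatorSpace ℂ where
  matNorm := scalarNorm
  matNorm_add_le x y := by
    simp only [scalarNorm_eq]; exact norm_add_le _ _
  matNorm_smul c x := by
    simp only [scalarNorm_eq]; exact norm_smul _ _
  eq_zero_of_matNorm x h := by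
    rw [scalarNorm_eq] at h; exact norm_eq_zero.mp h
  matNorm_oplus := norm_oplus_scalar
  matNorm_sandwich_le α x β := by
    rw [sandwich_eq_mul]
    simp only [scalarNorm_eq]
    exact (Matrix.l2_opNorm_mul _ _).trans (by gcongr; exact Matrix.l2_opNorm_mul _ _)
  matNorm_one x := by
    have : !![x] = Matrix.diagonal (fun _ : Fin 1 => x) := by
      ext i j; simp [Subsingleton.elim i j]
    rw [scalarNorm_eq, this, Matrix.l2_opNorm_diagonal]
    simp

lemma matNorm_scalar {n : ℕ} (x : Matrix (Fin n) (Fin n) ℂ) : matNorm x = scalarNorm x := rfl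

end ScalarOperatorSpace

section CompletelyBounded

variable {E F : Type*} [NormedAddCommGroup E] [NormedSpace ℂ E] [OperatorSpace E]
  [NormedAddCommGroup F] [NormedSpace ℂ F] [OperatorSpace F]

/-- The completely bounded norm of a bounded operator, as an extended nonnegative real:
the supremum over `k` of the norms of its entrywise action on `k × k` matrices. -/
def cbNorm (T : E →L[ℂ] F) : ℝ≥0∞ :=
  ⨆ (k : ℕ) (x : Matrix (Fin k) (Fin k) E) (_ : matNorm x ≤ 1),
    ENNReal.ofReal (matNorm (x.map T))

/-- The norm on `M_m(CB(E, F)) = CB(E, M_m(F))` of a matrix of operators, as an extended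
nonnegative real: the supremum, over the matrices `x` over `E` of norm at most one, of the norm of
the matrix `(T i j (x k l))`. -/
def matCBNorm {m : ℕ} (T : Matrix (Fin m) (Fin m) (E →L[ℂ] F)) : ℝ≥0∞ :=
  ⨆ (k : ℕ) (x : Matrix (Fin k) (Fin k) E) (_ : matNorm x ≤ 1),
    ENNReal.ofReal (matNorm (bilinAmp (fun S v => S v) T x))

lemma cbNorm_le_iff (T : E →L[ℂ] F) (C : ℝ) (hC : 0 ≤ C) :
    cbNorm T ≤ ENNReal.ofReal C ↔
      ∀ (k : ℕ) (x : Matrix (Fin k) (Fin k) E), matNorm (x.map T) ≤ C * matNorm x := by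
  simp only [cbNorm, iSup_le_iff, ENNReal.ofReal_le_ofReal_iff hC]
  constructor
  · intro h k x
    rcases (matNorm_nonneg x).eq_or_lt with h0 | h0
    · rw [eq_zero_of_matNorm x h0.symm]
      have : (0 : Matrix (Fin k) (Fin k) E).map T = 0 := by ext i j; simp
      rw [this, show matNorm (0 : Matrix (Fin k) (Fin k) F) = 0 from
        MatricialNorm.matNorm_zero _, show matNorm (0 : Matrix (Fin k) (Fin k) E) = 0 from
        MatricialNorm.matNorm_zero _, mul_zero]
    · have := h k (((matNorm x)⁻¹ : ℂ) • x) (by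
        rw [matNorm_smul, norm_inv, Complex.norm_real, Real.norm_of_nonneg h0.le,
          inv_mul_cancel₀ h0.ne'])
      rw [Matrix.map_smul _ _ (fun a => map_smul T _ a), matNorm_smul, norm_inv,
        Complex.norm_real, Real.norm_of_nonneg h0.le, inv_mul_le_iff₀ h0] at this
      linarith
  · intro h k x hx
    exact (h k x).trans (mul_le_of_le_one_right hC hx)

lemma matCBNorm_le_iff {m : ℕ} (T : Matrix (Fin m) (Fin m) (E →L[ℂ] F)) (C : ℝ) (hC : 0 ≤ C) :
    matCBNorm T ≤ ENNReal.ofReal C ↔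
      ∀ (k : ℕ) (x : Matrix (Fin k) (Fin k) E),
        matNorm (bilinAmp (fun S v => S v) T x) ≤ C * matNorm x := by
  simp only [matCBNorm, iSup_le_iff, ENNReal.ofReal_le_ofReal_iff hC]
  have hs : ∀ (k : ℕ) (c : ℂ) (x : Matrix (Fin k) (Fin k) E),
      bilinAmp (fun (S : E →L[ℂ] F) v => S v) T (c • x) =
        c • bilinAmp (fun (S : E →L[ℂ] F) v => S v) T x := by
    intro k c x
    ext i j
    simp [bilinAmp]
  constructor
  · intro h k x
    rcases (matNorm_nonneg x).eq_or_lt with h0 | h0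
    · have := hs k 0 x
      rw [zero_smul, zero_smul] at this
      rw [eq_zero_of_matNorm x h0.symm, this,
        show matNorm (0 : Matrix (Fin (m * k)) (Fin (m * k)) F) = 0 from
        MatricialNorm.matNorm_zero _, show matNorm (0 : Matrix (Fin k) (Fin k) E) = 0 from
        MatricialNorm.matNorm_zero _, mul_zero]
    · have := h k (((matNorm x)⁻¹ : ℂ) • x) (by
        rw [matNorm_smul, norm_inv, Complex.norm_real, Real.norm_of_nonneg h0.le,
          inv_mul_cancel₀ h0.ne'])
      rw [hs, matNorm_smul, norm_inv,
        Complex.norm_real, Real.norm_of_nonneg h0.le, inv_mul_le_iff₀ h0] at this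
      linarith
  · intro h k x hx
    exact (h k x).trans (mul_le_of_le_one_right hC hx)

lemma matNorm_map_le (T : E →L[ℂ] F) (hT : cbNorm T ≠ ⊤) {k : ℕ}
    (x : Matrix (Fin k) (Fin k) E) : matNorm (x.map T) ≤ (cbNorm T).toReal * matNorm x :=
  (cbNorm_le_iff T _ ENNReal.toReal_nonneg).1 (ENNReal.ofReal_toReal hT).ge k x

lemma matNorm_bilinAmp_le {m : ℕ} (T : Matrix (Fin m) (Fin m) (E →L[ℂ] F))
    (hT : matCBNorm T ≠ ⊤) {k : ℕ} (x : Matrix (Fin k) (Fin k) E) :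
    matNorm (bilinAmp (fun S v => S v) T x) ≤ (matCBNorm T).toReal * matNorm x :=
  (matCBNorm_le_iff T _ ENNReal.toReal_nonneg).1 (ENNReal.ofReal_toReal hT).ge k x

lemma cbNorm_ne_top_of (T : E →L[ℂ] F) (C : ℝ) (hC : 0 ≤ C)
    (h : ∀ (k : ℕ) (x : Matrix (Fin k) (Fin k) E), matNorm (x.map T) ≤ C * matNorm x) :
    cbNorm T ≠ ⊤ :=
  ne_top_of_le_ne_top ENNReal.ofReal_ne_top ((cbNorm_le_iff T C hC).2 h)

/-- The algebra `CB(E)` of the completely bounded operators on `E`. -/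
def CB (E : Type*) [NormedAddCommGroup E] [NormedSpace ℂ E] [OperatorSpace E] :
    Subalgebra ℂ (E →L[ℂ] E) where
  carrier := {T | cbNorm T ≠ ⊤}
  mul_mem' {S T} hS hT := by
    refine cbNorm_ne_top_of _ ((cbNorm S).toReal * (cbNorm T).toReal) (by positivity)
      fun k x => ?_
    have h1 := matNorm_map_le S hS (x.map T)
    have h2 := matNorm_map_le T hT x
    calc matNorm (x.map (S * T)) = matNorm ((x.map T).map S) := rfl
      _ ≤ (cbNorm S).toReal * matNorm (x.map T) := h1
      _ ≤ (cbNorm S).toReal * ((cbNorm T).toReal * matNorm x) := by gcongr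
      _ = _ := by ring
  add_mem' {S T} hS hT := by
    refine cbNorm_ne_top_of _ ((cbNorm S).toReal + (cbNorm T).toReal) (by positivity)
      fun k x => ?_
    have h1 := matNorm_map_le S hS x
    have h2 := matNorm_map_le T hT x
    calc matNorm (x.map (S + T)) = matNorm (x.map S + x.map T) := rfl
      _ ≤ matNorm (x.map S) + matNorm (x.map T) := matNorm_add_le _ _
      _ ≤ _ := by linarith
  algebraMap_mem' c := by
    refine cbNorm_ne_top_of _ ‖c‖ (norm_nonneg c) fun k x => ?_
    rw [← matNorm_smul]
    exact le_of_eq rfl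

end CompletelyBounded

section Dual

variable {E : Type*} [NormedAddCommGroup E] [NormedSpace ℂ E] [OperatorSpace E]

lemma scalarNorm_row_le {n : ℕ} (η : EuclideanSpace ℂ (Fin n)) :
    scalarNorm (Matrix.of fun (_ : Fin 1) j => η j) ≤ ‖η‖ := by
  refine scalarNorm_le _ _ (norm_nonneg _) fun ξ => ?_
  simp only [Matrix.of_apply, Finset.univ_unique, Finset.sum_const, Finset.card_singleton,
    one_smul]
  rw [EuclideanSpace.norm_sq_eq]
  calc ‖∑ j, η j * ξ j‖ ^ 2 ≤ (∑ j, ‖η j‖ * ‖ξ j‖) ^ 2 := by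
        gcongr
        exact (norm_sum_le _ _).trans (Finset.sum_le_sum fun j _ => (norm_mul _ _).le)
    _ ≤ _ := Finset.sum_mul_sq_le_sq_mul_sq _ _ _

lemma scalarNorm_col_le {n : ℕ} (η : EuclideanSpace ℂ (Fin n)) :
    scalarNorm (Matrix.of fun j (_ : Fin 1) => η j) ≤ ‖η‖ := by
  refine scalarNorm_le _ _ (norm_nonneg _) fun ξ => ?_
  simp [EuclideanSpace.norm_sq_eq, mul_pow, Finset.sum_mul]

/-- Multiplying a matrix by a row from the left and by a column from the right. -/
lemma norm_row_col_le {n : ℕ} (x : Matrix (Fin n) (Fin n) E) (η ξ : EuclideanSpace ℂ (Fin n)) :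
    ‖∑ k, ∑ l, (η k * ξ l) • x k l‖ ≤ ‖η‖ * matNorm x * ‖ξ‖ := by
  have h := MatricialNorm.matNorm_sandwich_le (OperatorSpace.toMatricialNorm (E := E))
    (Matrix.of fun (_ : Fin 1) j => η j) x (Matrix.of fun j (_ : Fin 1) => ξ j)
  have e : sandwich (Matrix.of fun (_ : Fin 1) j => η j) x (Matrix.of fun j (_ : Fin 1) => ξ j) =
      !![∑ k, ∑ l, (η k * ξ l) • x k l] := by
    ext i j
    simp [sandwich, Subsingleton.elim i 0, Subsingleton.elim j 0]
  rw [e] at h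
  rw [← matNorm_one]
  refine h.trans ?_
  have h1 := scalarNorm_row_le η
  have h2 := scalarNorm_col_le ξ
  have h3 := matNorm_nonneg x
  have h4 := scalarNorm_nonneg (Matrix.of fun j (_ : Fin 1) => ξ j)
  exact mul_le_mul (mul_le_mul_of_nonneg_right h1 h3) h2 h4 (by positivity)

lemma scalarNorm_le_of_row_col {n : ℕ} (M : Matrix (Fin n) (Fin n) ℂ) (C : ℝ) (hC : 0 ≤ C)
    (h : ∀ η ξ : EuclideanSpace ℂ (Fin n),
      ‖∑ k, ∑ l, (η k * ξ l) • M k l‖ ≤ ‖η‖ * C * ‖ξ‖) : scalarNorm M ≤ C := by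
  refine scalarNorm_le _ _ hC fun ξ => ?_
  set y : Fin n → ℂ := fun i => ∑ j, M i j * ξ j with hy
  set η : EuclideanSpace ℂ (Fin n) := WithLp.toLp 2 fun i => star (y i) with hη
  set ξ' : EuclideanSpace ℂ (Fin n) := WithLp.toLp 2 ξ with hξ
  have h1 := h η ξ'
  have e : ∑ k, ∑ l, (η k * ξ' l) • M k l = ((∑ k, ‖y k‖ ^ 2 : ℝ) : ℂ) := by
    rw [Complex.ofReal_sum]
    refine Finset.sum_congr rfl fun k _ => ?_
    rw [Complex.ofReal_pow, ← Complex.conj_mul', hy]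
    simp only [hη, hξ, smul_eq_mul, hy, Finset.mul_sum]
    refine Finset.sum_congr rfl fun l _ => ?_
    simp only [RCLike.star_def]
    ring
  have h2 : ‖η‖ ^ 2 = ∑ k, ‖y k‖ ^ 2 := by
    rw [EuclideanSpace.norm_sq_eq]; simp [hη]
  have h3 : ‖ξ'‖ ^ 2 = ∑ k, ‖ξ k‖ ^ 2 := by
    rw [EuclideanSpace.norm_sq_eq]
  rw [e, Complex.norm_real, Real.norm_of_nonneg (by positivity), ← h2] at h1
  change ∑ i, ‖y i‖ ^ 2 ≤ C ^ 2 * ∑ j, ‖ξ j‖ ^ 2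
  rw [← h2, ← h3, ← mul_pow]
  have h4 : ‖η‖ ≤ C * ‖ξ'‖ := by
    rcases (norm_nonneg η).eq_or_lt with h0 | h0
    · rw [← h0]; positivity
    · nlinarith
  gcongr

/-- A bounded functional is completely bounded with the same norm. -/
lemma matNorm_map_functional_le (f : StrongDual ℂ E) {k : ℕ} (x : Matrix (Fin k) (Fin k) E) :
    matNorm (x.map f) ≤ ‖f‖ * matNorm x := by
  have h0 := matNorm_nonneg x
  refine scalarNorm_le_of_row_col _ _ (by positivity) fun η ξ => ?_
  have : ∑ k, ∑ l, (η k * ξ l) • (x.map f) k l = f (∑ k, ∑ l, (η k * ξ l) • x k l) := by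
    simp [map_sum]
  rw [this]
  calc _ ≤ ‖f‖ * ‖∑ k, ∑ l, (η k * ξ l) • x k l‖ := f.le_opNorm _
    _ ≤ ‖f‖ * (‖η‖ * matNorm x * ‖ξ‖) := by gcongr; exact norm_row_col_le x η ξ
    _ = _ := by ring

/-- The evaluation of functionals at vectors. -/
abbrev dualEval (f : StrongDual ℂ E) (v : E) : ℂ := f v

lemma bilinAmp_dual_le {m k : ℕ} (f : Matrix (Fin m) (Fin m) (StrongDual ℂ E))
    (x : Matrix (Fin k) (Fin k) E) :
    matNorm (bilinAmp dualEval f x) ≤ (∑ i, ∑ j, ‖f i j‖) * matNorm x := by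
  have e : bilinAmp dualEval f x = ∑ i, ∑ j,
      sandwich (selMat fun l : Fin k => finProdFinEquiv (i, l)).transpose (x.map (f i j))
        (selMat fun l : Fin k => finProdFinEquiv (j, l)) := by
    ext a b
    obtain ⟨⟨i, l⟩, rfl⟩ := finProdFinEquiv.surjective a
    obtain ⟨⟨j, l'⟩, rfl⟩ := finProdFinEquiv.surjective b
    simp only [Matrix.sum_apply, bilinAmp, Matrix.reindex_apply, Matrix.submatrix_apply,
      Equiv.symm_apply_apply, Matrix.kroneckerMap_apply, sandwich, Matrix.of_apply, selMat,
      Matrix.transpose_apply, EmbeddingLike.apply_eq_iff_eq, Prod.mk.injEq, Matrix.map_apply,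
      mul_ite, mul_one, mul_zero, ite_smul, one_smul, zero_smul]
    rw [Finset.sum_eq_single i, Finset.sum_eq_single j, Finset.sum_eq_single l,
      Finset.sum_eq_single l']
    all_goals simp +contextual [eq_comm]
  rw [e]
  refine (MatricialNorm.matNorm_sum_le _ _ _).trans ?_
  rw [Finset.sum_mul]
  refine Finset.sum_le_sum fun i _ => (MatricialNorm.matNorm_sum_le _ _ _).trans ?_
  rw [Finset.sum_mul]
  refine Finset.sum_le_sum fun j _ => (MatricialNorm.matNorm_sandwich_le _ _ _ _).trans ?_
  have inj : ∀ i : Fin m, Function.Injective fun l : Fin k => finProdFinEquiv (i, l) :=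
    fun i a b h => by simpa using h
  have h1 := scalarNorm_selMat_transpose _ (inj i)
  have h2 := scalarNorm_selMat _ (inj j)
  have h3 := matNorm_map_functional_le (f i j) x
  have h4 := matNorm_nonneg (x.map (f i j))
  have h5 := scalarNorm_nonneg (selMat fun l : Fin k => finProdFinEquiv (j, l))
  calc _ ≤ (1 * matNorm (x.map (f i j))) * 1 := mul_le_mul
        (mul_le_mul_of_nonneg_right h1 h4) h2 h5 (by positivity)
    _ ≤ _ := by linarith

/-- The norm of `M_m(E*) = CB(E, M_m(ℂ))`. -/
def dualMatNorm {m : ℕ} (f : Matrix (Fin m) (Fin m) (StrongDual ℂ E)) : ℝ :=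
  (matCBNorm f).toReal

lemma matCBNorm_dual_ne_top {m : ℕ} (f : Matrix (Fin m) (Fin m) (StrongDual ℂ E)) :
    matCBNorm f ≠ ⊤ :=
  ne_top_of_le_ne_top ENNReal.ofReal_ne_top
    ((matCBNorm_le_iff f (∑ i, ∑ j, ‖f i j‖) (by positivity)).2
      fun _ x => bilinAmp_dual_le f x)

lemma bilinAmp_le_dualMatNorm {m k : ℕ} (f : Matrix (Fin m) (Fin m) (StrongDual ℂ E))
    (x : Matrix (Fin k) (Fin k) E) :
    matNorm (bilinAmp dualEval f x) ≤ dualMatNorm f * matNorm x :=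
  matNorm_bilinAmp_le f (matCBNorm_dual_ne_top f) x

lemma dualMatNorm_nonneg {m : ℕ} (f : Matrix (Fin m) (Fin m) (StrongDual ℂ E)) :
    0 ≤ dualMatNorm f := ENNReal.toReal_nonneg

lemma dualMatNorm_le {m : ℕ} (f : Matrix (Fin m) (Fin m) (StrongDual ℂ E)) (C : ℝ) (hC : 0 ≤ C)
    (h : ∀ (k : ℕ) (x : Matrix (Fin k) (Fin k) E),
      matNorm (bilinAmp dualEval f x) ≤ C * matNorm x) : dualMatNorm f ≤ C :=
  ENNReal.toReal_le_of_le_ofReal hC ((matCBNorm_le_iff f C hC).2 h)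

lemma dualMatNorm_smul_le {m : ℕ} (c : ℂ) (f : Matrix (Fin m) (Fin m) (StrongDual ℂ E)) :
    dualMatNorm (c • f) ≤ ‖c‖ * dualMatNorm f := by
  have h0 := dualMatNorm_nonneg f
  refine dualMatNorm_le _ _ (by positivity) fun k x => ?_
  have : bilinAmp dualEval (c • f) x = c • bilinAmp dualEval f x := by
    ext i j; simp [bilinAmp, dualEval]
  rw [this, matNorm_smul, mul_assoc]
  gcongr
  exact bilinAmp_le_dualMatNorm f x

lemma bilinAmp_sandwich {m n k : ℕ} (α : Matrix (Fin m) (Fin n) ℂ)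
    (f : Matrix (Fin n) (Fin n) (StrongDual ℂ E)) (β : Matrix (Fin n) (Fin m) ℂ)
    (x : Matrix (Fin k) (Fin k) E) :
    bilinAmp dualEval (sandwich α f β) x =
      sandwich (ampScalar k α) (bilinAmp dualEval f x) (ampScalar k β) := by
  ext a b
  obtain ⟨⟨i, l⟩, rfl⟩ := finProdFinEquiv.surjective a
  obtain ⟨⟨j, l'⟩, rfl⟩ := finProdFinEquiv.surjective b
  simp only [sandwich, Matrix.of_apply]
  rw [← finProdFinEquiv.sum_comp]
  simp only [← finProdFinEquiv.sum_comp (fun t => (_ * ampScalar k β t _) • _)]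
  simp only [Fintype.sum_prod_type, bilinAmp, ampScalar, Matrix.reindex_apply,
    Matrix.submatrix_apply, Equiv.symm_apply_apply, Matrix.kroneckerMap_apply, Matrix.of_apply,
    Matrix.one_apply, mul_ite, ite_mul, mul_one, mul_zero, zero_mul, ite_smul, zero_smul,
    Finset.sum_ite_eq', Finset.mem_univ, if_true, dualEval]
  simp

lemma matNorm_oplus_dual {m n k : ℕ} (f : Matrix (Fin m) (Fin m) (StrongDual ℂ E))
    (g : Matrix (Fin n) (Fin n) (StrongDual ℂ E)) (x : Matrix (Fin k) (Fin k) E) :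
    matNorm (bilinAmp dualEval (oplus f g) x) =
      max (matNorm (bilinAmp dualEval f x)) (matNorm (bilinAmp dualEval g x)) := by
  have h := MatricialNorm.matNorm_oplus (OperatorSpace.toMatricialNorm (E := ℂ))
    (bilinAmp dualEval f x) (bilinAmp dualEval g x)
  refine Eq.trans ?_ h
  let e : Fin ((m + n) * k) ≃ Fin (m * k + n * k) :=
    finProdFinEquiv.symm.trans (((finSumFinEquiv.symm.prodCongr (Equiv.refl (Fin k))).trans
      (Equiv.sumProdDistrib (Fin m) (Fin n) (Fin k))).trans
        ((finProdFinEquiv.sumCongr finProdFinEquiv).trans finSumFinEquiv))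
  rw [← MatricialNorm.matNorm_submatrix_equiv _ e]
  change MatricialNorm.matNorm _ _ = _
  congr 1
  ext a b
  obtain ⟨⟨i, l⟩, rfl⟩ := finProdFinEquiv.surjective a
  obtain ⟨⟨j, l'⟩, rfl⟩ := finProdFinEquiv.surjective b
  obtain ⟨i, rfl⟩ := finSumFinEquiv.surjective i
  obtain ⟨j, rfl⟩ := finSumFinEquiv.surjective j
  rcases i with i | i <;> rcases j with j | j <;>
  simp only [e, bilinAmp, oplus, Matrix.reindex_apply, Matrix.submatrix_apply,
    Equiv.symm_apply_apply, Matrix.kroneckerMap_apply, Matrix.fromBlocks_apply₁₁,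
    Matrix.fromBlocks_apply₁₂, Matrix.fromBlocks_apply₂₁, Matrix.fromBlocks_apply₂₂,
    Matrix.zero_apply, dualEval, Equiv.trans_apply, Equiv.prodCongr_apply, Prod.map,
    Equiv.refl_apply, Equiv.sumProdDistrib_apply_left, Equiv.sumProdDistrib_apply_right,
    Equiv.sumCongr_apply, Sum.map_inl, Sum.map_inr, zero_apply]

lemma dualMatNorm_add_le {m : ℕ} (f g : Matrix (Fin m) (Fin m) (StrongDual ℂ E)) :
    dualMatNorm (f + g) ≤ dualMatNorm f + dualMatNorm g := by
  have h1 := dualMatNorm_nonneg f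
  have h2 := dualMatNorm_nonneg g
  refine dualMatNorm_le _ _ (add_nonneg h1 h2) fun k x => ?_
  have : bilinAmp dualEval (f + g) x = bilinAmp dualEval f x + bilinAmp dualEval g x := by
    ext i j; simp [bilinAmp, dualEval]
  rw [this, add_mul]
  exact (matNorm_add_le _ _).trans
    (add_le_add (bilinAmp_le_dualMatNorm f x) (bilinAmp_le_dualMatNorm g x))

/-- The dual of an operator space, as an operator space. -/
instance : OperatorSpace (StrongDual ℂ E) where
  matNorm := dualMatNorm
  matNorm_add_le := dualMatNorm_add_le
  matNorm_smul c f := by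
    refine le_antisymm (dualMatNorm_smul_le c f) ?_
    rcases eq_or_ne c 0 with rfl | hc
    · simpa using dualMatNorm_nonneg _
    · have := dualMatNorm_smul_le c⁻¹ (c • f)
      rw [inv_smul_smul₀ hc, norm_inv, ← div_eq_inv_mul, le_div_iff₀ (norm_pos_iff.2 hc)] at this
      linarith
  eq_zero_of_matNorm {m} f h := by
    ext i j v
    have h1 := bilinAmp_le_dualMatNorm f !![v]
    have h2 := norm_entry_le (bilinAmp dualEval f !![v]) (finProdFinEquiv (i, 0))
      (finProdFinEquiv (j, 0))
    rw [h, zero_mul] at h1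
    have h3 := norm_le_zero_iff.1 (h2.trans h1)
    simpa [bilinAmp, dualEval] using h3
  matNorm_oplus f g := by
    have hf := dualMatNorm_nonneg f
    have hg := dualMatNorm_nonneg g
    refine le_antisymm ?_ (max_le ?_ ?_)
    · refine dualMatNorm_le _ _ (le_max_of_le_left hf) fun k x => ?_
      have hx := matNorm_nonneg x
      rw [matNorm_oplus_dual, max_mul_of_nonneg _ _ hx]
      exact max_le_max (bilinAmp_le_dualMatNorm f x) (bilinAmp_le_dualMatNorm g x)
    · refine dualMatNorm_le _ _ (dualMatNorm_nonneg _) fun k x => ?_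
      exact (le_max_left _ _).trans
        ((matNorm_oplus_dual f g x).ge.trans (bilinAmp_le_dualMatNorm _ x))
    · refine dualMatNorm_le _ _ (dualMatNorm_nonneg _) fun k x => ?_
      exact (le_max_right _ _).trans
        ((matNorm_oplus_dual f g x).ge.trans (bilinAmp_le_dualMatNorm _ x))
  matNorm_sandwich_le α f β := by
    have h1 := scalarNorm_nonneg α
    have h2 := scalarNorm_nonneg β
    have h3 := dualMatNorm_nonneg f
    refine dualMatNorm_le _ _ (by positivity) fun k x => ?_
    rw [bilinAmp_sandwich]
    refine (MatricialNorm.matNorm_sandwich_le _ _ _ _).trans ?_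
    have h4 := scalarNorm_ampScalar k α
    have h5 := scalarNorm_ampScalar k β
    have h6 := bilinAmp_le_dualMatNorm f x
    have h7 := matNorm_nonneg x
    have h8 := matNorm_nonneg (bilinAmp dualEval f x)
    calc _ ≤ scalarNorm α * (dualMatNorm f * matNorm x) * scalarNorm β :=
          mul_le_mul (mul_le_mul h4 h6 h8 h1) h5 (scalarNorm_nonneg _) (by positivity)
      _ = _ := by ring
  matNorm_one f := by
    refine le_antisymm ?_ ?_
    · refine dualMatNorm_le _ _ (norm_nonneg f) fun k x => ?_
      have := bilinAmp_dual_le !![f] x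
      simpa using this
    · refine f.opNorm_le_bound (dualMatNorm_nonneg _) fun v => ?_
      have h1 := bilinAmp_le_dualMatNorm !![f] !![v]
      have h2 := norm_entry_le (bilinAmp dualEval !![f] !![v]) (finProdFinEquiv (0, 0))
        (finProdFinEquiv (0, 0))
      rw [matNorm_one] at h1
      refine le_trans ?_ (h2.trans h1)
      simp [bilinAmp, dualEval]

end Dual

section ProjectiveTensorProduct

variable {E F : Type*} [NormedAddCommGroup E] [NormedSpace ℂ E] [OperatorSpace E]
  [NormedAddCommGroup F] [NormedSpace ℂ F] [OperatorSpace F]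

/-- The element `α (v ⊗ w) β` of `E ⊗ F`, for a row `α` and a column `β` indexed by pairs and for
square matrices `v` over `E` and `w` over `F`. -/
def tensorRep {p q : ℕ} (α : EuclideanSpace ℂ (Fin p × Fin q)) (v : Matrix (Fin p) (Fin p) E)
    (w : Matrix (Fin q) (Fin q) F) (β : EuclideanSpace ℂ (Fin p × Fin q)) : E ⊗[ℂ] F :=
  ∑ s, ∑ t, (α s * β t) • (v s.1 t.1 ⊗ₜ[ℂ] w s.2 t.2)

/-- The values `‖α‖ ‖v‖ ‖w‖ ‖β‖` for all representations `u = α (v ⊗ w) β`. -/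
def projValues (u : E ⊗[ℂ] F) : Set ℝ :=
  {r | ∃ (p q : ℕ) (α : EuclideanSpace ℂ (Fin p × Fin q)) (v : Matrix (Fin p) (Fin p) E)
    (w : Matrix (Fin q) (Fin q) F) (β : EuclideanSpace ℂ (Fin p × Fin q)),
    u = tensorRep α v w β ∧ r = ‖α‖ * matNorm v * matNorm w * ‖β‖}

/-- The operator space projective tensor norm on `E ⊗ F` (at level one). -/
def projNorm (u : E ⊗[ℂ] F) : ℝ := sInf (projValues u)

lemma projValues_nonneg (u : E ⊗[ℂ] F) {r : ℝ} (h : r ∈ projValues u) : 0 ≤ r := by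
  obtain ⟨p, q, α, v, w, β, -, rfl⟩ := h
  have := matNorm_nonneg v
  have := matNorm_nonneg w
  positivity

lemma projValues_zero : (0 : ℝ) ∈ projValues (0 : E ⊗[ℂ] F) :=
  ⟨0, 0, 0, 0, 0, 0, by simp [tensorRep], by simp⟩

lemma projValues_tmul (e : E) (f : F) : ‖e‖ * ‖f‖ ∈ projValues (e ⊗ₜ[ℂ] f) := by
  refine ⟨1, 1, EuclideanSpace.single (0, 0) 1, !![e], !![f], EuclideanSpace.single (0, 0) 1,
    ?_, ?_⟩
  · simp [tensorRep]
  · simp [matNorm_one]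

lemma projValues_smul (c : ℂ) (u : E ⊗[ℂ] F) {r : ℝ} (h : r ∈ projValues u) :
    ‖c‖ * r ∈ projValues (c • u) := by
  obtain ⟨p, q, α, v, w, β, rfl, rfl⟩ := h
  refine ⟨p, q, c • α, v, w, β, ?_, ?_⟩
  · simp only [tensorRep, Finset.smul_sum, smul_smul, PiLp.smul_apply, smul_eq_mul, mul_assoc]
  · rw [norm_smul]; ring

/-- Normalization of the representations of a tensor. -/
lemma projValues_normalize (u : E ⊗[ℂ] F) {r : ℝ} (h : r ∈ projValues u) :
    ∃ (p q : ℕ) (α : EuclideanSpace ℂ (Fin p × Fin q)) (v : Matrix (Fin p) (Fin p) E)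
      (w : Matrix (Fin q) (Fin q) F) (β : EuclideanSpace ℂ (Fin p × Fin q)),
      u = tensorRep α v w β ∧ ‖α‖ ^ 2 ≤ r ∧ ‖β‖ ^ 2 ≤ r ∧ matNorm v ≤ 1 ∧ matNorm w ≤ 1 := by
  have hr := projValues_nonneg u h
  obtain ⟨p, q, α, v, w, β, rfl, hre⟩ := h
  have hv := matNorm_nonneg v
  have hw := matNorm_nonneg w
  rcases hr.eq_or_lt with h0 | h0
  · have hz : tensorRep α v w β = 0 := by
      rw [← h0] at hre
      have := hre.symm
      simp only [mul_eq_zero, norm_eq_zero] at this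
      rcases this with ((h | h) | h) | h
      · simp [tensorRep, h]
      · simp [tensorRep, eq_zero_of_matNorm v h]
      · simp [tensorRep, eq_zero_of_matNorm w h]
      · simp [tensorRep, h]
    rw [hz]
    refine ⟨0, 0, 0, 0, 0, 0, by simp [tensorRep], by simpa using hr, by simpa using hr, ?_, ?_⟩
    · exact (MatricialNorm.matNorm_zero _).trans_le zero_le_one
    · exact (MatricialNorm.matNorm_zero _).trans_le zero_le_one
  · have ha : 0 < ‖α‖ := (norm_nonneg _).lt_of_ne fun h => by
      rw [hre, ← h] at h0; simp at h0
    have hb : 0 < ‖β‖ := (norm_nonneg _).lt_of_ne fun h => by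
      rw [hre, ← h] at h0; simp at h0
    have hv' : 0 < matNorm v := hv.lt_of_ne fun h => by rw [hre, ← h] at h0; simp at h0
    have hw' : 0 < matNorm w := hw.lt_of_ne fun h => by rw [hre, ← h] at h0; simp at h0
    have hs := Real.sq_sqrt hr
    refine ⟨p, q, ((Real.sqrt r / ‖α‖ : ℝ) : ℂ) • α, (((matNorm v)⁻¹ : ℝ) : ℂ) • v,
      (((matNorm w)⁻¹ : ℝ) : ℂ) • w, ((Real.sqrt r / ‖β‖ : ℝ) : ℂ) • β, ?_, ?_, ?_, ?_, ?_⟩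
    · have key : ((Real.sqrt r / ‖α‖ : ℝ) : ℂ) * ((Real.sqrt r / ‖β‖ : ℝ) : ℂ) *
          ((((matNorm v)⁻¹ : ℝ) : ℂ) * (((matNorm w)⁻¹ : ℝ) : ℂ)) = 1 := by
        norm_cast
        rw [show Real.sqrt r / ‖α‖ * (Real.sqrt r / ‖β‖) * ((matNorm v)⁻¹ * (matNorm w)⁻¹) =
          Real.sqrt r ^ 2 / (‖α‖ * matNorm v * matNorm w * ‖β‖) by field_simp]
        rw [hs, ← hre, div_self h0.ne']
      simp only [tensorRep]
      refine Finset.sum_congr rfl fun s _ => Finset.sum_congr rfl fun t _ => ?_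
      simp only [Matrix.smul_apply, TensorProduct.smul_tmul', TensorProduct.tmul_smul, smul_smul,
        PiLp.smul_apply, smul_eq_mul]
      congr 1
      rw [← one_mul (α s * β t), ← key]
      ring_nf
    · rw [norm_smul, Complex.norm_real, Real.norm_of_nonneg (by positivity),
        div_mul_cancel₀ _ ha.ne', hs]
    · rw [norm_smul, Complex.norm_real, Real.norm_of_nonneg (by positivity),
        div_mul_cancel₀ _ hb.ne', hs]
    · rw [matNorm_smul, Complex.norm_real, Real.norm_of_nonneg (by positivity),
        inv_mul_cancel₀ hv'.ne']
    · rw [matNorm_smul, Complex.norm_real, Real.norm_of_nonneg (by positivity),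
        inv_mul_cancel₀ hw'.ne']

/-- The direct sum of two rows (or columns) indexed by pairs. -/
def rowSum {p p' q q' : ℕ} (α : EuclideanSpace ℂ (Fin p × Fin q))
    (α' : EuclideanSpace ℂ (Fin p' × Fin q')) :
    EuclideanSpace ℂ (Fin (p + p') × Fin (q + q')) :=
  WithLp.toLp 2 fun s => Sum.elim
    (fun i => Sum.elim (fun k => α (i, k)) (fun _ => 0) (finSumFinEquiv.symm s.2))
    (fun i => Sum.elim (fun _ => 0) (fun k => α' (i, k)) (finSumFinEquiv.symm s.2))
    (finSumFinEquiv.symm s.1)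

lemma sum_pair_split {M : Type*} [AddCommMonoid M] {p p' q q' : ℕ}
    (g : Fin (p + p') × Fin (q + q') → M) :
    ∑ s, g s = (∑ i, ∑ k, g (finSumFinEquiv (Sum.inl i), finSumFinEquiv (Sum.inl k)) +
        ∑ i, ∑ k, g (finSumFinEquiv (Sum.inl i), finSumFinEquiv (Sum.inr k))) +
      (∑ i, ∑ k, g (finSumFinEquiv (Sum.inr i), finSumFinEquiv (Sum.inl k)) +
        ∑ i, ∑ k, g (finSumFinEquiv (Sum.inr i), finSumFinEquiv (Sum.inr k))) := by
  rw [Fintype.sum_prod_type, ← finSumFinEquiv.sum_comp, Fintype.sum_sum_type]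
  simp only [← finSumFinEquiv.sum_comp (fun k : Fin (q + q') => g (_, k)), Fintype.sum_sum_type,
    Finset.sum_add_distrib]

lemma norm_rowSum_sq {p p' q q' : ℕ} (α : EuclideanSpace ℂ (Fin p × Fin q))
    (α' : EuclideanSpace ℂ (Fin p' × Fin q')) :
    ‖rowSum α α'‖ ^ 2 = ‖α‖ ^ 2 + ‖α'‖ ^ 2 := by
  simp only [EuclideanSpace.norm_sq_eq]
  rw [sum_pair_split]
  simp [rowSum, Fintype.sum_prod_type]

lemma tensorRep_rowSum {p p' q q' : ℕ} (α : EuclideanSpace ℂ (Fin p × Fin q))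
    (α' : EuclideanSpace ℂ (Fin p' × Fin q')) (β : EuclideanSpace ℂ (Fin p × Fin q))
    (β' : EuclideanSpace ℂ (Fin p' × Fin q')) (v : Matrix (Fin p) (Fin p) E)
    (v' : Matrix (Fin p') (Fin p') E) (w : Matrix (Fin q) (Fin q) F)
    (w' : Matrix (Fin q') (Fin q') F) :
    tensorRep (rowSum α α') (oplus v v') (oplus w w') (rowSum β β') =
      tensorRep α v w β + tensorRep α' v' w' β' := by
  simp only [tensorRep]
  rw [sum_pair_split]
  simp only [sum_pair_split (fun t => (_ * rowSum β β' t) • _)]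
  simp [rowSum, oplus, Fintype.sum_prod_type]

lemma projValues_add (u u' : E ⊗[ℂ] F) {r r' : ℝ} (h : r ∈ projValues u)
    (h' : r' ∈ projValues u') : ∃ t ∈ projValues (u + u'), t ≤ r + r' := by
  have hr := projValues_nonneg u h
  have hr' := projValues_nonneg u' h'
  obtain ⟨p, q, α, v, w, β, rfl, ha, hb, hv, hw⟩ := projValues_normalize u h
  obtain ⟨p', q', α', v', w', β', rfl, ha', hb', hv', hw'⟩ := projValues_normalize u' h'
  refine ⟨_, ⟨p + p', q + q', rowSum α α', oplus v v', oplus w w', rowSum β β',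
    (tensorRep_rowSum α α' β β' v v' w w').symm, rfl⟩, ?_⟩
  have e1 : matNorm (oplus v v') ≤ 1 :=
    (MatricialNorm.matNorm_oplus _ v v').trans_le (max_le hv hv')
  have e2 : matNorm (oplus w w') ≤ 1 :=
    (MatricialNorm.matNorm_oplus _ w w').trans_le (max_le hw hw')
  have e3 := norm_rowSum_sq α α'
  have e4 := norm_rowSum_sq β β'
  have e5 := matNorm_nonneg (oplus v v')
  have e6 := matNorm_nonneg (oplus w w')
  calc ‖rowSum α α'‖ * matNorm (oplus v v') * matNorm (oplus w w') * ‖rowSum β β'‖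
      ≤ ‖rowSum α α'‖ * 1 * 1 * ‖rowSum β β'‖ := by gcongr
    _ ≤ r + r' := by
        nlinarith [sq_nonneg (‖rowSum α α'‖ - ‖rowSum β β'‖)]

lemma projValues_nonempty (u : E ⊗[ℂ] F) : (projValues u).Nonempty := by
  induction u with
  | zero => exact ⟨0, projValues_zero⟩
  | tmul e f => exact ⟨_, projValues_tmul e f⟩
  | add u u' h h' =>
    obtain ⟨t, ht, -⟩ := projValues_add u u' h.some_mem h'.some_mem
    exact ⟨t, ht⟩

lemma projValues_bddBelow (u : E ⊗[ℂ] F) : BddBelow (projValues u) :=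
  ⟨0, fun _ h => projValues_nonneg u h⟩

lemma projNorm_le_of_mem {u : E ⊗[ℂ] F} {r : ℝ} (h : r ∈ projValues u) : projNorm u ≤ r :=
  csInf_le (projValues_bddBelow u) h

lemma projNorm_nonneg (u : E ⊗[ℂ] F) : 0 ≤ projNorm u :=
  le_csInf (projValues_nonempty u) fun _ h => projValues_nonneg u h

lemma projNorm_add_le (u u' : E ⊗[ℂ] F) : projNorm (u + u') ≤ projNorm u + projNorm u' := by
  refine le_of_forall_pos_le_add fun ε hε => ?_
  obtain ⟨r, hr, hr'⟩ := exists_lt_of_csInf_lt (projValues_nonempty u)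
    (show sInf (projValues u) < projNorm u + ε / 2 by unfold projNorm; linarith)
  obtain ⟨s, hs, hs'⟩ := exists_lt_of_csInf_lt (projValues_nonempty u')
    (show sInf (projValues u') < projNorm u' + ε / 2 by unfold projNorm; linarith)
  obtain ⟨t, ht, ht'⟩ := projValues_add u u' hr hs
  linarith [projNorm_le_of_mem ht]

lemma projNorm_smul_le (c : ℂ) (u : E ⊗[ℂ] F) : projNorm (c • u) ≤ ‖c‖ * projNorm u := by
  rcases eq_or_ne c 0 with rfl | hc
  · simpa using projNorm_le_of_mem (projValues_zero (E := E) (F := F))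
  · have hc' := norm_pos_iff.2 hc
    rw [← div_le_iff₀' hc']
    refine le_csInf (projValues_nonempty u) fun r hr => ?_
    rw [div_le_iff₀' hc']
    exact projNorm_le_of_mem (projValues_smul c u hr)

lemma projNorm_smul (c : ℂ) (u : E ⊗[ℂ] F) : projNorm (c • u) = ‖c‖ * projNorm u := by
  refine le_antisymm (projNorm_smul_le c u) ?_
  rcases eq_or_ne c 0 with rfl | hc
  · simpa using projNorm_nonneg _
  · have := projNorm_smul_le c⁻¹ (c • u)
    rw [inv_smul_smul₀ hc, norm_inv, ← div_eq_inv_mul, le_div_iff₀ (norm_pos_iff.2 hc)] at this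
    linarith

end ProjectiveTensorProduct

/-- The algebraic tensor product, equipped with the operator space projective norm. -/
def AlgProjTensor (E F : Type*) [AddCommGroup E] [Module ℂ E] [AddCommGroup F] [Module ℂ F] :
    Type _ := E ⊗[ℂ] F

section ProjectiveTensorProduct

open UniformSpace

variable {E F : Type*} [NormedAddCommGroup E] [NormedSpace ℂ E] [OperatorSpace E]
  [NormedAddCommGroup F] [NormedSpace ℂ F] [OperatorSpace F]

instance : AddCommGroup (AlgProjTensor E F) := inferInstanceAs (AddCommGroup (E ⊗[ℂ] F))

instance : Module ℂ (AlgProjTensor E F) := inferInstanceAs (Module ℂ (E ⊗[ℂ] F))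

/-- The identity map from `E ⊗ F` to its normed version. -/
def toAlgProjTensor : E ⊗[ℂ] F ≃ₗ[ℂ] AlgProjTensor E F := LinearEquiv.refl ℂ (E ⊗[ℂ] F)

instance : Norm (AlgProjTensor E F) := ⟨fun u => projNorm (toAlgProjTensor.symm u)⟩

lemma algProjTensor_core : SeminormedSpace.Core ℂ (AlgProjTensor E F) where
  norm_nonneg u := projNorm_nonneg (toAlgProjTensor.symm u)
  norm_smul c u := projNorm_smul c (toAlgProjTensor.symm u)
  norm_triangle u u' := projNorm_add_le (toAlgProjTensor.symm u) (toAlgProjTensor.symm u')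

instance : SeminormedAddCommGroup (AlgProjTensor E F) :=
  SeminormedAddCommGroup.ofCore algProjTensor_core

instance : NormedSpace ℂ (AlgProjTensor E F) where
  norm_smul_le c u := (algProjTensor_core.norm_smul c u).le

variable (E F) in
/-- The projective tensor product `E ⊗̂ F` of operator spaces. -/
abbrev ProjTensor : Type _ := Completion (AlgProjTensor E F)

/-- The elementary tensors in `E ⊗̂ F`. -/
def projTmul (e : E) (f : F) : ProjTensor E F :=
  ((toAlgProjTensor (e ⊗ₜ[ℂ] f) : AlgProjTensor E F) : Completion (AlgProjTensor E F))

lemma norm_toAlgProjTensor (u : E ⊗[ℂ] F) : ‖toAlgProjTensor u‖ = projNorm u := rfl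

/-- The functional `f ⊗ x ↦ f (T x)` on the algebraic tensor product `E* ⊗ E`. -/
def algPairing (T : E →L[ℂ] E) : StrongDual ℂ E ⊗[ℂ] E →ₗ[ℂ] ℂ :=
  TensorProduct.lift (LinearMap.mk₂ ℂ (fun (f : StrongDual ℂ E) (x : E) => f (T x))
    (fun _ _ _ => rfl) (fun _ _ _ => rfl) (fun _ _ _ => by simp) (fun _ _ _ => by simp))

lemma norm_algPairing_le (T : CB E) (u : StrongDual ℂ E ⊗[ℂ] E) :
    ‖algPairing (T : E →L[ℂ] E) u‖ ≤ (cbNorm (T : E →L[ℂ] E)).toReal * projNorm u := by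
  have hC : 0 ≤ (cbNorm (T : E →L[ℂ] E)).toReal := ENNReal.toReal_nonneg
  have key : ∀ r ∈ projValues u,
      ‖algPairing (T : E →L[ℂ] E) u‖ ≤ (cbNorm (T : E →L[ℂ] E)).toReal * r := by
    rintro r ⟨p, q, α, v, w, β, rfl, rfl⟩
    have h1 := bilinAmp_le_dualMatNorm v (w.map (T : E →L[ℂ] E))
    have h2 := matNorm_map_le (T : E →L[ℂ] E) T.2 w
    set α' : EuclideanSpace ℂ (Fin (p * q)) :=
      LinearIsometryEquiv.piLpCongrLeft 2 ℂ ℂ finProdFinEquiv α with hα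
    set β' : EuclideanSpace ℂ (Fin (p * q)) :=
      LinearIsometryEquiv.piLpCongrLeft 2 ℂ ℂ finProdFinEquiv β with hβ
    have h3 := norm_row_col_le (bilinAmp dualEval v (w.map (T : E →L[ℂ] E))) α' β'
    rw [hα, hβ, LinearIsometryEquiv.norm_map, LinearIsometryEquiv.norm_map] at h3
    have e : algPairing (T : E →L[ℂ] E) (tensorRep α v w β) = ∑ k, ∑ l, (α' k * β' l) •
        bilinAmp dualEval v (w.map (T : E →L[ℂ] E)) k l := by
      rw [← finProdFinEquiv.sum_comp]
      simp only [← finProdFinEquiv.sum_comp (fun l => (_ * β' l) • _)]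
      simp [tensorRep, algPairing, hα, hβ, bilinAmp, dualEval]
    rw [e]
    refine h3.trans ?_
    have h4 : 0 ≤ matNorm v := matNorm_nonneg v
    calc ‖α‖ * matNorm (bilinAmp dualEval v (w.map (T : E →L[ℂ] E))) * ‖β‖
        ≤ ‖α‖ * (matNorm v * ((cbNorm (T : E →L[ℂ] E)).toReal * matNorm w)) * ‖β‖ := by
          gcongr
          exact h1.trans (mul_le_mul_of_nonneg_left h2 h4)
      _ = _ := by ring
  rcases hC.eq_or_lt with h0 | h0
  · obtain ⟨r, hr⟩ := projValues_nonempty u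
    have := key r hr
    rw [← h0, zero_mul] at this ⊢
    exact this
  · rw [← div_le_iff₀' h0]
    refine le_csInf (projValues_nonempty u) fun r hr => ?_
    rw [div_le_iff₀' h0]
    exact key r hr

/-- The duality between `CB(E)` and `E* ⊗̂ E`: the functional on `E* ⊗̂ E` given by a completely
bounded operator `T`, with `⟨T, f ⊗ x⟩ = f (T x)`. -/
def cbPairing (T : CB E) : StrongDual ℂ (ProjTensor (StrongDual ℂ E) E) :=
  (LinearMap.mkContinuous ((algPairing (T : E →L[ℂ] E)).comp
      (toAlgProjTensor (E := StrongDual ℂ E) (F := E)).symm.toLinearMap)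
    (cbNorm (T : E →L[ℂ] E)).toReal
    (fun u => norm_algPairing_le T (toAlgProjTensor.symm u))).extend Completion.toComplL

lemma cbPairing_tmul (T : CB E) (f : StrongDual ℂ E) (x : E) :
    cbPairing T (projTmul f x) = f ((T : E →L[ℂ] E) x) := by
  have h := ContinuousLinearMap.extend_eq
    (LinearMap.mkContinuous ((algPairing (T : E →L[ℂ] E)).comp
      (toAlgProjTensor (E := StrongDual ℂ E) (F := E)).symm.toLinearMap)
      (cbNorm (T : E →L[ℂ] E)).toReal
      (fun u => norm_algPairing_le T (toAlgProjTensor.symm u)))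
    (e := Completion.toComplL) Completion.denseRange_coe
    (Completion.isUniformInducing_coe _) (toAlgProjTensor (f ⊗ₜ[ℂ] x))
  refine Eq.trans h ?_
  simp [algPairing]

end ProjectiveTensorProduct

/-- The weak-star topology on `X` coming from a duality `X → Y*`: the topology of pointwise
convergence on `Y`. -/
abbrev weakStarTopology {X Y : Type*} [NormedAddCommGroup Y] [NormedSpace ℂ Y]
    (e : X → StrongDual ℂ Y) : TopologicalSpace X :=
  TopologicalSpace.induced (fun x y => e x y) inferInstance

/-- A completely contractive dual Banach algebra `A` with predual `P`: as an operator space, `A` is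
the dual of the operator space `P`; the multiplication is a completely bounded bilinear map (so that
the completely contractive ones are covered); and it is separately weak-star continuous. -/
structure CCDualBanachAlgebra (A P : Type*) [NonUnitalNormedRing A] [NormedSpace ℂ A]
    [IsScalarTower ℂ A A] [SMulCommClass ℂ A A] [OperatorSpace A]
    [NormedAddCommGroup P] [NormedSpace ℂ P] [CompleteSpace P] [OperatorSpace P] where
  toDual : A ≃ₗᵢ[ℂ] StrongDual ℂ P
  matNorm_toDual : ∀ (m : ℕ) (a : Matrix (Fin m) (Fin m) A),
    matNorm (a.map toDual) = matNorm a
  mul_completelyBounded : ∃ C : ℝ, ∀ (m k : ℕ) (a : Matrix (Fin m) (Fin m) A)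
    (b : Matrix (Fin k) (Fin k) A),
    matNorm (bilinAmp (fun x y : A => x * y) a b) ≤ C * matNorm a * matNorm b
  continuous_mul_left : ∀ a : A,
    Continuous[weakStarTopology toDual, weakStarTopology toDual] fun x => a * x
  continuous_mul_right : ∀ a : A,
    Continuous[weakStarTopology toDual, weakStarTopology toDual] fun x => x * a

namespace CCDualBanachAlgebra

variable {A P : Type*} [NonUnitalNormedRing A] [NormedSpace ℂ A]
    [IsScalarTower ℂ A A] [SMulCommClass ℂ A A] [OperatorSpace A]
    [NormedAddCommGroup P] [NormedSpace ℂ P] [CompleteSpace P] [OperatorSpace P]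
    (D : CCDualBanachAlgebra A P)

lemma eq_of_toDual {f g : P} (h : ∀ b : A, D.toDual b f = D.toDual b g) : f = g := by
  refine (SeparatingDual.eq_iff_forall_dual_eq (R := ℂ)).2 fun l => ?_
  simpa using h (D.toDual.symm l)

/-- A weak-star continuous linear operator on `A` has a pre-adjoint on `P`. -/
lemma exists_preadjoint (R : A →ₗ[ℂ] A)
    (hR : Continuous[weakStarTopology D.toDual, weakStarTopology D.toDual] R) (f : P) :
    ∃ g : P, ∀ b : A, D.toDual b g = D.toDual (R b) f := by
  let B : P → A →ₗ[ℂ] ℂ := fun g =>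
    { toFun := fun b => D.toDual b g
      map_add' := fun _ _ => by simp
      map_smul' := fun _ _ => by simp }
  have hc : Continuous[weakStarTopology D.toDual, inferInstance] (B f ∘ₗ R) := by
    let : TopologicalSpace A := weakStarTopology D.toDual
    have h1 : Continuous fun b : A => fun y => D.toDual b y := continuous_induced_dom
    exact (continuous_apply f).comp (h1.comp hR)
  have hmem : B f ∘ₗ R ∈ Submodule.span ℂ (Set.range B) := by
    rw [LinearMap.mem_span_iff_continuous]
    have e : weakStarTopology D.toDual =
        ⨅ g, TopologicalSpace.induced (B g) (inferInstance : TopologicalSpace ℂ) :=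
      induced_to_pi _
    rwa [e] at hc
  have hall : ∀ L ∈ Submodule.span ℂ (Set.range B), ∃ g : P, ∀ b, D.toDual b g = L b := by
    intro L hL
    induction hL using Submodule.span_induction with
    | mem L h => obtain ⟨g, rfl⟩ := h; exact ⟨g, fun _ => rfl⟩
    | zero => exact ⟨0, fun _ => by simp⟩
    | add L L' _ _ h h' =>
      obtain ⟨g, hg⟩ := h
      obtain ⟨g', hg'⟩ := h'
      exact ⟨g + g', fun b => by rw [map_add, hg, hg']; rfl⟩
    | smul c L _ h =>
      obtain ⟨g, hg⟩ := h
      exact ⟨c • g, fun b => by rw [map_smul, hg]; rfl⟩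
  exact hall _ hmem

/-- The left module action of `A` on the predual: `⟨b, a · f⟩ = ⟨b a, f⟩`. -/
def lact (a : A) (f : P) : P :=
  (D.exists_preadjoint (LinearMap.mulRight ℂ a) (D.continuous_mul_right a) f).choose

lemma toDual_lact (a b : A) (f : P) : D.toDual b (D.lact a f) = D.toDual (b * a) f :=
  (D.exists_preadjoint (LinearMap.mulRight ℂ a) (D.continuous_mul_right a) f).choose_spec b

/-- The right module action of `A` on the predual: `⟨b, f · a⟩ = ⟨a b, f⟩`. -/
def ract (f : P) (a : A) : P :=
  (D.exists_preadjoint (LinearMap.mulLeft ℂ a) (D.continuous_mul_left a) f).choose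

lemma toDual_ract (a b : A) (f : P) : D.toDual b (D.ract f a) = D.toDual (a * b) f :=
  (D.exists_preadjoint (LinearMap.mulLeft ℂ a) (D.continuous_mul_left a) f).choose_spec b

lemma lact_lact (a b : A) (f : P) : D.lact a (D.lact b f) = D.lact (a * b) f :=
  D.eq_of_toDual fun c => by simp only [toDual_lact, mul_assoc]

variable {n : ℕ} (φ : Matrix (Fin n) (Fin n) P)

/-- The map `a ↦ a · φ`, from `A` to the matrices over the predual. -/
def orbitMap : A →ₗ[ℂ] Matrix (Fin n) (Fin n) P where
  toFun a := φ.map (D.lact a)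
  map_add' a b := by
    ext i j
    refine D.eq_of_toDual fun c => ?_
    simp [toDual_lact, mul_add]
  map_smul' r a := by
    ext i j
    refine D.eq_of_toDual fun c => ?_
    simp [toDual_lact, mul_smul_comm]

/-- The space `A · φ`. -/
def orbit : Submodule ℂ (Matrix (Fin n) (Fin n) P) := LinearMap.range (D.orbitMap φ)

/-- The entries of the elements of `A · φ`. -/
def orbitEntry (i j : Fin n) : D.orbit φ →ₗ[ℂ] P where
  toFun x := (x : Matrix (Fin n) (Fin n) P) i j
  map_add' _ _ := rfl
  map_smul' _ _ := rfl

/-- The vector `a · φ` of `A · φ`. -/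
def orbitVec (a : A) : D.orbit φ := ⟨D.orbitMap φ a, a, rfl⟩

/-- The module action of `A` on `A · φ`. -/
def orbitAct (a : A) (x : D.orbit φ) : D.orbit φ :=
  ⟨(x : Matrix (Fin n) (Fin n) P).map (D.lact a), by
    obtain ⟨_, b, rfl⟩ := x
    refine ⟨a * b, ?_⟩
    ext i j
    simp [orbitMap, lact_lact]⟩

/-- A matricial norm on `A · φ` that satisfies the inequalities of an admissible operator norm. -/
structure OrbitNorm extends MatricialNorm (D.orbit φ) where
  matNorm_act_le : ∀ (m k : ℕ) (a : Matrix (Fin m) (Fin m) A)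
    (x : Matrix (Fin k) (Fin k) (D.orbit φ)),
    toMatricialNorm.matNorm (bilinAmp (D.orbitAct φ) a x) ≤
      _root_.matNorm a * toMatricialNorm.matNorm x
  le_matNorm : ∀ (m : ℕ) (a : Matrix (Fin m) (Fin m) A),
    _root_.matNorm (bilinAmp D.lact a φ) ≤ toMatricialNorm.matNorm (a.map (D.orbitVec φ))
  matNorm_le : ∀ (m : ℕ) (a : Matrix (Fin m) (Fin m) A),
    toMatricialNorm.matNorm (a.map (D.orbitVec φ)) ≤ _root_.matNorm a * _root_.matNorm φ

namespace OrbitNorm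

variable {D φ} (N : D.OrbitNorm φ)

/-- The operator space `E_φ`: the completion of `A · φ`. -/
abbrev E : Type _ := UniformSpace.Completion N.toMatricialNorm.Space

/-- The vector `a · φ` in `E_φ`. -/
def vec (a : A) : N.E := ((N.toMatricialNorm.toSpace (D.orbitVec φ a) :
  N.toMatricialNorm.Space) : UniformSpace.Completion N.toMatricialNorm.Space)

lemma norm_entry_le (x : D.orbit φ) (i j : Fin n) :
    ‖(x : Matrix (Fin n) (Fin n) P) i j‖ ≤ ‖N.toMatricialNorm.toSpace x‖ := by
  obtain ⟨_, a, rfl⟩ := x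
  have h := N.le_matNorm 1 !![a]
  have h' := _root_.norm_entry_le (bilinAmp D.lact !![a] φ) (finProdFinEquiv (0, i))
    (finProdFinEquiv (0, j))
  refine le_trans (le_of_eq ?_) (h'.trans (h.trans (le_of_eq ?_)))
  · simp [bilinAmp, orbitMap]
  · rw [MatricialNorm.space_norm_def]
    congr 1
    ext i j
    simp [orbitVec]

/-- The entries of the inclusion of `E_φ` in the matrices over the predual: the continuous
extensions of the entries of the inclusion of `A · φ`. -/
def entry (i j : Fin n) : N.E →L[ℂ] P :=
  (LinearMap.mkContinuous ((D.orbitEntry φ i j).comp N.toMatricialNorm.toSpace.symm.toLinearMap)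
    1 (fun x => by
      rw [one_mul]
      exact N.norm_entry_le (N.toMatricialNorm.toSpace.symm x) i j)).extend
    UniformSpace.Completion.toComplL

/-- The inclusion `ι_φ` of `E_φ` in the matrices over the predual. -/
def incl (x : N.E) : Matrix (Fin n) (Fin n) P := Matrix.of fun i j => N.entry i j x

lemma incl_vec (a : A) : N.incl (N.vec a) = φ.map (D.lact a) := by
  ext i j
  have h := ContinuousLinearMap.extend_eq
    (LinearMap.mkContinuous
      ((D.orbitEntry φ i j).comp N.toMatricialNorm.toSpace.symm.toLinearMap) 1 (fun x => by
        rw [one_mul]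
        exact N.norm_entry_le (N.toMatricialNorm.toSpace.symm x) i j))
    (e := UniformSpace.Completion.toComplL)
    UniformSpace.Completion.denseRange_coe (UniformSpace.Completion.isUniformInducing_coe _)
    (N.toMatricialNorm.toSpace (D.orbitVec φ a))
  exact h

/-- The adjoint `ι_φ*`, sending a matrix `c` over `A` to the functional
`x ↦ ∑ i j, ⟨c i j, (ι_φ x) i j⟩` on `E_φ`. -/
def inclAdjoint (c : Matrix (Fin n) (Fin n) A) : StrongDual ℂ N.E :=
  ∑ i, ∑ j, (D.toDual (c i j)).comp (N.entry i j)

/-- `S` is the bounded map `E_φ* ⊗̂ E_φ → P` that sends `ι_φ*(c) ⊗ a · φ` to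
`∑ i j, a · φ i j · c i j`. -/
def IsInducedMap (S : ProjTensor (StrongDual ℂ N.E) N.E →L[ℂ] P) : Prop :=
  ∀ (c : Matrix (Fin n) (Fin n) A) (a : A),
    S (projTmul (N.inclAdjoint c) (N.vec a)) =
      ∑ i, ∑ j, D.ract (D.lact a (φ i j)) (c i j)

end OrbitNorm

/-- An admissible operator norm for `φ`: moreover the completion `E_φ` of `A · φ` is reflexive, and
the extended inclusion of `E_φ` in the matrices over the predual is injective. -/
structure AdmissibleNorm extends OrbitNorm D φ where
  reflexive : Function.Surjective (NormedSpace.inclusionInDoubleDual ℂ toOrbitNorm.E)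
  injective : Function.Injective toOrbitNorm.incl

end CCDualBanachAlgebra

end

noncomputable section

/-! ### The module action on `A · φ`, and the predual `P` as a closed subspace of the dual of `A` -/

namespace CCDualBanachAlgebra

variable {A P : Type*} [NonUnitalNormedRing A] [NormedSpace ℂ A]
    [IsScalarTower ℂ A A] [SMulCommClass ℂ A A] [OperatorSpace A]
    [NormedAddCommGroup P] [NormedSpace ℂ P] [CompleteSpace P] [OperatorSpace P]
    {D : CCDualBanachAlgebra A P} {n : ℕ} {φ : Matrix (Fin n) (Fin n) P}

/-! The representation is built first, and `S_φ` is recovered as its pre-adjoint. The module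
inequality bounds the action of `a` on `A · φ` by `‖a‖`, so the action extends to `E_φ`. By density
the matrix form of the same inequality passes to the completion (`matNorm_bilinAmp_action_le`),
which is complete contractivity. Multiplicativity is associativity of `A`, read off on the dense set
of vectors `b · φ`.

Each `u` in `E_φ* ⊗̂ E_φ` now gives the bounded functional `a ↦ ⟨T_φ(a), u⟩` on `A`. The point is
that it lies in `P`, viewed isometrically inside the dual of `A`. For `u = ι_φ*(c) ⊗ a · φ` its
value at `b` is `∑ ⟨c i j, (b a) · φ i j⟩ = ∑ ⟨b, a · φ i j · c i j⟩`, so it is induced by the very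
element of `P` prescribed for `S_φ(u)` (`repFunctional_projTmul`). Since `P` is complete, its image
is closed, and it suffices that these special tensors span a dense subspace.

The vectors `a · φ` are dense by construction. The functionals `ι_φ*(c)` are norm dense in `E_φ*`
(`denseRange_inclAdjoint`): a functional on `E_φ*` that annihilates them is, by reflexivity,
evaluation at some `x` in `E_φ`; then `ι_φ(x) = 0`, and injectivity gives `x = 0`. So every
functional `a ↦ ⟨T_φ(a), u⟩` comes from `P` (`repFunctional_mem_range`), which defines `S_φ`. The
same density gives uniqueness, and `⟨T_φ(a), u⟩ = ⟨a, S_φ(u)⟩` makes `T_φ` weak-star continuous. -/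

lemma lact_add (a : A) (f g : P) : D.lact a (f + g) = D.lact a f + D.lact a g :=
  -- The action is a chosen pre-adjoint, so its linearity is checked after pairing with `A`, which
  -- separates the points of `P`.
  D.eq_of_toDual fun c => by simp [toDual_lact]

lemma lact_smul (a : A) (r : ℂ) (f : P) : D.lact a (r • f) = r • D.lact a f :=
  D.eq_of_toDual fun c => by simp [toDual_lact]

variable (D φ) in
/-- The module action of an element of `A` on `A · φ`, as a linear map. -/
def orbitActLinear (a : A) : D.orbit φ →ₗ[ℂ] D.orbit φ where
  toFun := D.orbitAct φ a
  map_add' x y := by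
    ext i j
    exact lact_add a _ _
  map_smul' r x := by
    ext i j
    exact lact_smul a r _

lemma orbitAct_orbitVec (a b : A) :
    D.orbitAct φ a (D.orbitVec φ b) = D.orbitVec φ (a * b) := by
  ext i j
  exact D.lact_lact a b _

/-- Both sides are `⟨c b a, f⟩`. Read as a function of `b`, this says that the functional `b ↦ ⟨c,
(b a) · f⟩` is induced by the element `a · f · c` of the predual; it is the algebraic source of the
formula for `S_φ`. -/
lemma toDual_ract_lact (a b c : A) (f : P) :
    D.toDual b (D.ract (D.lact a f) c) = D.toDual c (D.lact (b * a) f) := by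
  rw [toDual_ract, toDual_lact, toDual_lact, mul_assoc]

variable (D) in
/-- The inclusion of the predual `P` in the dual of `A`. -/
def preInclusion : P →ₗᵢ[ℂ] StrongDual ℂ A where
  toLinearMap := ((ContinuousLinearMap.compL ℂ A (StrongDual ℂ P) ℂ).flip
      (D.toDual.toContinuousLinearEquiv : A →L[ℂ] StrongDual ℂ P)).toLinearMap ∘ₗ
    (NormedSpace.inclusionInDoubleDual ℂ P).toLinearMap
  norm_map' f := by
    -- Composing with the isometry of `A` onto the dual of `P` keeps the norm, so what remains is
    -- that the canonical map of `P` into its bidual is isometric.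
    refine (ContinuousLinearMap.opNorm_comp_linearIsometryEquiv
      (NormedSpace.inclusionInDoubleDual ℂ P f) D.toDual).trans ?_
    exact (NormedSpace.inclusionInDoubleDualLi ℂ (E := P)).norm_map f

lemma preInclusion_apply (f : P) (a : A) : D.preInclusion f a = D.toDual a f := rfl

/-- An isometric image of a complete space is closed. This lets membership in `P` pass from special
tensors to limits of their combinations. -/
lemma isClosed_range_preInclusion :
    IsClosed (LinearMap.range D.preInclusion.toLinearMap : Set (StrongDual ℂ A)) := by
  have := D.preInclusion.isometry.isClosedEmbedding.isClosed_range
  exact this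

/-! ### The representation on `E_φ` and its complete contractivity -/

namespace OrbitNorm

variable (N : D.OrbitNorm φ)

lemma exists_vec_eq_coe (x : N.toMatricialNorm.Space) : ∃ a, N.vec a = x := by
  obtain ⟨_, a, rfl⟩ := x
  exact ⟨a, rfl⟩

lemma denseRange_vec : DenseRange N.vec := by
  refine UniformSpace.Completion.denseRange_coe.mono ?_
  rintro _ ⟨x, rfl⟩
  exact N.exists_vec_eq_coe x

/-- The vectors `a · φ` are themselves dense, since they fill the uncompleted space. The algebraic
identities of the representation thereby reduce to identities between products in `A`. -/
lemma ext_vec {F : Type*} [NormedAddCommGroup F] [NormedSpace ℂ F] {R R' : N.E →L[ℂ] F}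
    (h : ∀ a, R (N.vec a) = R' (N.vec a)) : R = R' :=
  ContinuousLinearMap.ext_on (N.denseRange_vec.mono Submodule.subset_span) (by rintro _ ⟨a, rfl⟩; exact h a)

lemma vec_add (a b : A) : N.vec (a + b) = N.vec a + N.vec b := by
  rw [vec, vec, vec, ← UniformSpace.Completion.coe_add, ← map_add]
  congr 2
  exact Subtype.ext (map_add (D.orbitMap φ) a b)

lemma vec_smul (r : ℂ) (a : A) : N.vec (r • a) = r • N.vec a := by
  rw [vec, vec, ← UniformSpace.Completion.coe_smul, ← map_smul]
  congr 2
  exact Subtype.ext (map_smul (D.orbitMap φ) r a)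

/-- The `1 × 1` case of the module inequality; it supplies the bound that allows the extension to
the completion. -/
lemma norm_orbitAct_le (a : A) (x : D.orbit φ) :
    ‖N.toMatricialNorm.toSpace (D.orbitAct φ a x)‖ ≤ ‖a‖ * ‖N.toMatricialNorm.toSpace x‖ := by
  have h := N.matNorm_act_le 1 1 !![a] !![x]
  have e : bilinAmp (D.orbitAct φ) !![a] !![x] = !![D.orbitAct φ a x] := by
    ext i j
    simp [bilinAmp]
  rw [e, _root_.matNorm_one] at h
  exact h

/-- The operator on `E_φ` extending the module action of an element of `A` on `A · φ`. -/
def action (a : A) : N.E →L[ℂ] N.E :=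
  (UniformSpace.Completion.toComplL.comp (LinearMap.mkContinuous
    (N.toMatricialNorm.toSpace.toLinearMap ∘ₗ D.orbitActLinear φ a ∘ₗ
      N.toMatricialNorm.toSpace.symm.toLinearMap) ‖a‖
    (fun x => N.norm_orbitAct_le a (N.toMatricialNorm.toSpace.symm x)))).extend
    UniformSpace.Completion.toComplL

lemma action_coe (a : A) (x : D.orbit φ) :
    N.action a (N.toMatricialNorm.toSpace x : N.toMatricialNorm.Space) =
      (N.toMatricialNorm.toSpace (D.orbitAct φ a x) : N.toMatricialNorm.Space) := by
  exact ContinuousLinearMap.extend_eq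
    (UniformSpace.Completion.toComplL.comp (LinearMap.mkContinuous
      (N.toMatricialNorm.toSpace.toLinearMap ∘ₗ D.orbitActLinear φ a ∘ₗ
        N.toMatricialNorm.toSpace.symm.toLinearMap) ‖a‖
      (fun x => N.norm_orbitAct_le a (N.toMatricialNorm.toSpace.symm x))))
    (e := UniformSpace.Completion.toComplL)
    UniformSpace.Completion.denseRange_coe (UniformSpace.Completion.isUniformInducing_coe _)
    (N.toMatricialNorm.toSpace x)

lemma action_vec (a b : A) : N.action a (N.vec b) = N.vec (a * b) := by
  rw [vec, action_coe, orbitAct_orbitVec, vec]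

/-- This is the complete contractivity of the representation, tested on a matrix `x`. For `x` over
`A · φ` it is the module inequality of the norm, and the general case follows by approximation. -/
lemma matNorm_bilinAmp_action_le {m k : ℕ} (a : Matrix (Fin m) (Fin m) A)
    (x : Matrix (Fin k) (Fin k) N.E) :
    matNorm (bilinAmp (fun S v => S v) (a.map N.action) x) ≤ matNorm a * matNorm x := by
  have hc : Continuous fun x : Matrix (Fin k) (Fin k) N.E =>
      bilinAmp (fun S v => S v) (a.map N.action) x := by
    refine continuous_matrix fun i j => ?_
    simp only [bilinAmp, Matrix.reindex_apply, Matrix.submatrix_apply, Matrix.kroneckerMap_apply]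
    exact (ContinuousLinearMap.continuous _).comp (continuous_id.matrix_elem _ _)
  -- With `a` fixed, both sides are continuous in `x`, and the matrices over the uncompleted space
  -- are dense.
  refine isClosed_property denseRange_matCoe
    (p := fun x : Matrix (Fin k) (Fin k) N.E =>
      complMatNorm (bilinAmp (fun S v => S v) (a.map N.action) x) ≤ matNorm a * complMatNorm x)
    (isClosed_le (continuous_complMatNorm.comp hc)
      (continuous_const.mul continuous_complMatNorm)) (fun y => ?_) x
  have e : bilinAmp (fun S v => S v) (a.map N.action) (matCoe y) =
      matCoe (E := N.toMatricialNorm.Space) (bilinAmp (D.orbitAct φ) a y) := by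
    ext i j
    exact N.action_coe _ _
  rw [e, complMatNorm_coe, complMatNorm_coe]
  exact N.matNorm_act_le m k a y

lemma matNorm_map_action_le (a : A) {k : ℕ} (x : Matrix (Fin k) (Fin k) N.E) :
    matNorm (x.map (N.action a)) ≤ ‖a‖ * matNorm x := by
  have h := N.matNorm_bilinAmp_action_le !![a] x
  rw [_root_.matNorm_one] at h
  refine le_trans (le_of_eq ?_) h
  -- The amplification by a `1 × 1` matrix is indexed by `Fin (1 * k)`; transporting it to `Fin k`
  -- does not change the matrix norm.
  let e : Fin k ≃ Fin (1 * k) := (Equiv.uniqueProd (Fin k) (Fin 1)).symm.trans finProdFinEquiv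
  refine Eq.trans ?_ (MatricialNorm.matNorm_submatrix_equiv _ e _)
  change MatricialNorm.matNorm _ _ = _
  congr 1
  ext i j
  simp [bilinAmp, e]

lemma action_mem_CB (a : A) : N.action a ∈ CB N.E :=
  cbNorm_ne_top_of _ ‖a‖ (norm_nonneg a) fun _ x => N.matNorm_map_action_le a x

lemma cbNorm_action_le (a : A) : (cbNorm (N.action a)).toReal ≤ ‖a‖ :=
  ENNReal.toReal_le_of_le_ofReal (norm_nonneg a)
    ((cbNorm_le_iff _ _ (norm_nonneg a)).2 fun _ x => N.matNorm_map_action_le a x)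

/-- The representation of `A` on `E_φ` extending the module action on `A · φ`. -/
def rep : A →ₙₐ[ℂ] CB N.E where
  toFun a := ⟨N.action a, N.action_mem_CB a⟩
  map_smul' r a := Subtype.ext <| N.ext_vec fun b => by
    simp [action_vec, smul_mul_assoc, vec_smul]
  map_zero' := Subtype.ext <| N.ext_vec fun b => by
    have := N.vec_smul 0 b
    rw [zero_smul, zero_smul] at this
    simp [action_vec, this]
  map_add' a b := Subtype.ext <| N.ext_vec fun c => by
    simp [action_vec, add_mul, vec_add]
  map_mul' a b := Subtype.ext <| N.ext_vec fun c => by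
    simp [action_vec, mul_assoc]

lemma coe_rep (a : A) : (N.rep a : N.E →L[ℂ] N.E) = N.action a := rfl

end OrbitNorm
end CCDualBanachAlgebra

/-! ### Density of elementary tensors in the projective tensor product -/

section ProjTensor

open UniformSpace

variable {E F : Type*} [NormedAddCommGroup E] [NormedSpace ℂ E] [OperatorSpace E]
  [NormedAddCommGroup F] [NormedSpace ℂ F] [OperatorSpace F]

lemma norm_projTmul_le (e : E) (f : F) : ‖projTmul e f‖ ≤ ‖e‖ * ‖f‖ := by
  rw [projTmul, Completion.norm_coe]
  exact projNorm_le_of_mem (projValues_tmul e f)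

variable (E F) in
/-- The bounded bilinear map sending a pair of vectors to its elementary tensor. -/
def projTmulL : E →L[ℂ] F →L[ℂ] ProjTensor E F :=
  LinearMap.mkContinuous₂
    ((TensorProduct.mk ℂ E F).compr₂ ((Completion.toComplL (𝕜 := ℂ)
      (E := AlgProjTensor E F)).toLinearMap ∘ₗ toAlgProjTensor.toLinearMap)) 1
    (fun e f => by
      rw [one_mul]
      exact norm_projTmul_le e f)

/-- The algebraic tensor product is dense in its completion, and each of its elements is a finite
sum of elementary tensors. -/
lemma dense_span_projTmul :
    Dense (Submodule.span ℂ (Set.range fun p : E × F => projTmul p.1 p.2) :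
      Set (ProjTensor E F)) := by
  refine (Completion.denseRange_coe (α := AlgProjTensor E F)).mono ?_
  rintro _ ⟨u, rfl⟩
  change ((toAlgProjTensor (toAlgProjTensor.symm u) : AlgProjTensor E F) : ProjTensor E F) ∈ _
  induction toAlgProjTensor.symm u with
  | zero => rw [map_zero, Completion.coe_zero]; exact zero_mem _
  | tmul e f => exact Submodule.subset_span ⟨(e, f), rfl⟩
  | add u v hu hv => rw [map_add, Completion.coe_add]; exact add_mem hu hv

/-- The elementary tensors of the vectors of two dense sets span a dense subspace. -/
lemma dense_span_projTmul_of_denseRange {ι κ : Type*} {e : ι → E} {f : κ → F}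
    (he : DenseRange e) (hf : DenseRange f) :
    Dense (Submodule.span ℂ (Set.range fun p : ι × κ => projTmul (e p.1) (f p.2)) :
      Set (ProjTensor E F)) := by
  have hsub : Submodule.span ℂ (Set.range fun p : E × F => projTmul p.1 p.2) ≤
      (Submodule.span ℂ
        (Set.range fun p : ι × κ => projTmul (e p.1) (f p.2))).topologicalClosure := by
    rw [Submodule.span_le]
    rintro _ ⟨⟨x, y⟩, rfl⟩
    -- Joint continuity of `(x, y) ↦ x ⊗ y` puts every elementary tensor in the closed span of those
    -- formed from the two dense families.
    have hc : Continuous fun p : E × F => projTmul p.1 p.2 :=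
      (projTmulL E F).continuous₂
    exact isClosed_property (he.prodMap hf)
      ((Submodule.isClosed_topologicalClosure _).preimage hc)
      (fun p => Submodule.le_topologicalClosure _ (Submodule.subset_span (Set.mem_range_self p)))
      (x, y)
  have := dense_span_projTmul (E := E) (F := F)
  rw [← dense_closure]
  exact this.mono hsub

lemma ext_projTmul {E F G : Type*} [NormedAddCommGroup E] [NormedSpace ℂ E] [OperatorSpace E]
    [NormedAddCommGroup F] [NormedSpace ℂ F] [OperatorSpace F] [NormedAddCommGroup G]
    [NormedSpace ℂ G] {R R' : ProjTensor E F →L[ℂ] G}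
    (h : ∀ e f, R (projTmul e f) = R' (projTmul e f)) : R = R' :=
  ContinuousLinearMap.ext_on dense_span_projTmul (by rintro _ ⟨p, rfl⟩; exact h _ _)

/-- The pairing is an extension by continuity made separately for each operator, so linearity in the
operator is verified on elementary tensors. -/
lemma cbPairing_add {E : Type*} [NormedAddCommGroup E] [NormedSpace ℂ E] [OperatorSpace E]
    (R R' : CB E) : cbPairing (R + R') = cbPairing R + cbPairing R' :=
  ext_projTmul fun f x => by simp [cbPairing_tmul]

lemma cbPairing_smul {E : Type*} [NormedAddCommGroup E] [NormedSpace ℂ E] [OperatorSpace E]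
    (r : ℂ) (R : CB E) : cbPairing (r • R) = r • cbPairing R :=
  ext_projTmul fun f x => by simp [cbPairing_tmul]

end ProjTensor

/-! ### Two general facts on bounded functionals -/

/-- A family of functionals on `U`, depending linearly and contractively on a vector of `V`, as a
bounded operator from `U` to the dual of `V`. -/
def flipOfBound {V U : Type*} [NormedAddCommGroup V] [NormedSpace ℂ V] [NormedAddCommGroup U]
    [NormedSpace ℂ U] (L : V → StrongDual ℂ U) (hadd : ∀ a b, L (a + b) = L a + L b)
    (hsmul : ∀ (r : ℂ) a, L (r • a) = r • L a) (hL : ∀ a u, ‖L a u‖ ≤ ‖a‖ * ‖u‖) :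
    U →L[ℂ] StrongDual ℂ V :=
  (LinearMap.mkContinuous (⟨⟨L, hadd⟩, hsmul⟩ : V →ₗ[ℂ] StrongDual ℂ U) 1 fun a => by
    rw [one_mul]
    exact ContinuousLinearMap.opNorm_le_bound _ (norm_nonneg a) (hL a)).flip

/-- A point outside a closed subspace is separated from it by a functional. -/
lemma exists_dual_ne_zero_of_notMem {V : Type*} [NormedAddCommGroup V] [NormedSpace ℂ V]
    {K : Submodule ℂ V} (hK : IsClosed (K : Set V)) {f : V} (hf : f ∉ K) :
    ∃ g : StrongDual ℂ V, (∀ x ∈ K, g x = 0) ∧ g f ≠ 0 := by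
  have : IsClosed (K : Set V) := hK
  have h0 : (Submodule.Quotient.mk f : V ⧸ K) ≠ 0 := by
    rwa [Ne, Submodule.Quotient.mk_eq_zero]
  -- As `K` is closed, the quotient seminorm is a norm. By Hahn–Banach some functional takes the
  -- value `‖f + K‖ ≠ 0` at the class of `f`, and its composition with the quotient map vanishes on
  -- `K`.
  obtain ⟨g, -, hg⟩ := exists_dual_vector ℂ (Submodule.Quotient.mk f : V ⧸ K)
    (norm_ne_zero_iff.2 h0)
  refine ⟨g.comp K.mkQL, fun x hx => ?_, fun h => h0 (norm_eq_zero.1 ?_)⟩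
  · change g (Submodule.Quotient.mk x) = 0
    rw [(Submodule.Quotient.mk_eq_zero K).2 hx, map_zero]
  · exact Complex.ofReal_eq_zero.1 (hg.symm.trans h)

/-! ### Norm density of the range of `ι_φ*` -/

namespace CCDualBanachAlgebra

variable {A P : Type*} [NonUnitalNormedRing A] [NormedSpace ℂ A]
    [IsScalarTower ℂ A A] [SMulCommClass ℂ A A] [OperatorSpace A]
    [NormedAddCommGroup P] [NormedSpace ℂ P] [CompleteSpace P] [OperatorSpace P]
    {D : CCDualBanachAlgebra A P} {n : ℕ} {φ : Matrix (Fin n) (Fin n) P}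

namespace OrbitNorm

variable (N : D.OrbitNorm φ)

lemma inclAdjoint_apply (c : Matrix (Fin n) (Fin n) A) (x : N.E) :
    N.inclAdjoint c x = ∑ i, ∑ j, D.toDual (c i j) (N.incl x i j) := by
  simp [inclAdjoint, incl]

/-- The adjoint `ι_φ*` as a linear map. -/
def inclAdjointLinear : Matrix (Fin n) (Fin n) A →ₗ[ℂ] StrongDual ℂ N.E where
  toFun := N.inclAdjoint
  map_add' c d := by
    ext x
    simp [inclAdjoint_apply, Finset.sum_add_distrib]
  map_smul' r c := by
    ext x
    simp [inclAdjoint_apply, Finset.mul_sum]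

lemma incl_zero : N.incl 0 = 0 := by
  ext i j
  simp [incl]

/-- If `E_φ` is reflexive and `ι_φ` is injective, then the range of `ι_φ*` is dense. -/
lemma denseRange_inclAdjoint
    (hr : Function.Surjective (NormedSpace.inclusionInDoubleDual ℂ N.E))
    (hi : Function.Injective N.incl) : DenseRange N.inclAdjoint := by
  change Dense (LinearMap.range N.inclAdjointLinear : Set (StrongDual ℂ N.E))
  rw [Submodule.dense_iff_topologicalClosure_eq_top]
  by_contra hne
  obtain ⟨f, hf⟩ : ∃ f, f ∉ (LinearMap.range N.inclAdjointLinear).topologicalClosure := by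
    by_contra! h
    exact hne (eq_top_iff.2 fun x _ => h x)
  set K := (LinearMap.range N.inclAdjointLinear).topologicalClosure with hK
  have hKc : IsClosed (K : Set (StrongDual ℂ N.E)) := Submodule.isClosed_topologicalClosure _
  obtain ⟨g, hgK, hg⟩ := exists_dual_ne_zero_of_notMem hKc hf
  -- Reflexivity enters here: the annihilating functional `g` on `E_φ*` is evaluation at a vector
  -- `x`. Injectivity of `ι_φ` alone would only give weak-star density of the range.
  obtain ⟨x, hx⟩ := hr g
  have hx' : ∀ h : StrongDual ℂ N.E, h x = g h := fun h =>
    congrArg (fun l : StrongDual ℂ (StrongDual ℂ N.E) => l h) hx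
  have hzero : ∀ c, N.inclAdjoint c x = 0 := fun c =>
    (hx' _).trans (hgK _ (Submodule.le_topologicalClosure _ ⟨c, rfl⟩))
  have hx0 : x = 0 := by
    refine hi ?_
    rw [incl_zero]
    ext i j
    refine D.eq_of_toDual fun b => ?_
    -- Matrices with a single nonzero entry `b` isolate the pairing of `b` with one entry of
    -- `ι_φ(x)`.
    have h := hzero (Matrix.single i j b)
    rw [inclAdjoint_apply, Finset.sum_eq_single i, Finset.sum_eq_single j] at h
    · simpa using h
    · intro j' _ hj
      simp [hj.symm]
    · simp
    · intro i' _ hi'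
      simp [hi'.symm]
    · simp
  exact hg (by rw [← hx', hx0, map_zero])

/-! ### The functionals `a ↦ ⟨T_φ(a), u⟩` on `A` -/

lemma norm_cbPairing_rep_le (a : A) (u : ProjTensor (StrongDual ℂ N.E) N.E) :
    ‖cbPairing (N.rep a) u‖ ≤ ‖a‖ * ‖u‖ := by
  refine UniformSpace.Completion.induction_on u
    (isClosed_le (by fun_prop) (by fun_prop)) fun v => ?_
  -- On the algebraic tensor product the pairing is given by `algPairing`. Its bound there is the
  -- completely bounded norm of the action of `a`, which is at most `‖a‖`; hence the estimate is
  -- uniform in both variables.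
  have h : cbPairing (N.rep a) (v : ProjTensor (StrongDual ℂ N.E) N.E) =
      algPairing (N.action a) (toAlgProjTensor.symm v) :=
    ContinuousLinearMap.extend_eq
      (LinearMap.mkContinuous ((algPairing (N.action a)).comp
        (toAlgProjTensor (E := StrongDual ℂ N.E) (F := N.E)).symm.toLinearMap)
        (cbNorm (N.action a)).toReal
        (fun u => norm_algPairing_le (N.rep a) (toAlgProjTensor.symm u)))
      (e := UniformSpace.Completion.toComplL) UniformSpace.Completion.denseRange_coe
      (UniformSpace.Completion.isUniformInducing_coe _) v
  rw [h, UniformSpace.Completion.norm_coe]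
  exact (norm_algPairing_le (N.rep a) _).trans
    (mul_le_mul_of_nonneg_right (N.cbNorm_action_le a) (projNorm_nonneg _))

lemma cbPairing_rep_add (a b : A) :
    cbPairing (N.rep (a + b)) = cbPairing (N.rep a) + cbPairing (N.rep b) :=
  (congrArg cbPairing (map_add N.rep a b)).trans (cbPairing_add _ _)

lemma cbPairing_rep_smul (r : ℂ) (a : A) :
    cbPairing (N.rep (r • a)) = r • cbPairing (N.rep a) :=
  (congrArg cbPairing (map_smul N.rep r a)).trans (cbPairing_smul _ _)

/-- The map sending `u ∈ E_φ* ⊗̂ E_φ` to the functional `a ↦ ⟨T_φ(a), u⟩` on `A`. -/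
def repFunctional : ProjTensor (StrongDual ℂ N.E) N.E →L[ℂ] StrongDual ℂ A :=
  flipOfBound (fun a => cbPairing (N.rep a)) N.cbPairing_rep_add N.cbPairing_rep_smul
    N.norm_cbPairing_rep_le

lemma repFunctional_apply (u : ProjTensor (StrongDual ℂ N.E) N.E) (a : A) :
    N.repFunctional u a = cbPairing (N.rep a) u := rfl

/-- At `b` both sides equal `∑ ⟨c i j, (b a) · φ i j⟩`, by `toDual_ract_lact`. So on these tensors
the functional is already weak-star continuous, and its representative in `P` is the value required
of `S_φ`. -/
lemma repFunctional_projTmul (c : Matrix (Fin n) (Fin n) A) (a : A) :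
    N.repFunctional (projTmul (N.inclAdjoint c) (N.vec a)) =
      D.preInclusion (∑ i, ∑ j, D.ract (D.lact a (φ i j)) (c i j)) := by
  ext b
  rw [repFunctional_apply, cbPairing_tmul, coe_rep, action_vec, inclAdjoint_apply,
    preInclusion_apply, incl_vec]
  simp [toDual_ract_lact]

/-! ### The pre-adjoint `S_φ`: uniqueness and construction -/

/-- A map with the values that determine `S_φ` is the pre-adjoint of the representation. -/
lemma isInducedMap_iff (hd : DenseRange N.inclAdjoint)
    (S : ProjTensor (StrongDual ℂ N.E) N.E →L[ℂ] P) :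
    N.IsInducedMap S ↔ ∀ u, D.preInclusion (S u) = N.repFunctional u := by
  constructor
  · intro h u
    -- Two bounded maps agree on tensors with dense span. As `P` embeds injectively in the dual of
    -- `A`, this determines `S`, which is the uniqueness claim.
    have : D.preInclusion.toContinuousLinearMap.comp S = N.repFunctional :=
      ContinuousLinearMap.ext_on (dense_span_projTmul_of_denseRange hd N.denseRange_vec) (by
        rintro _ ⟨⟨c, a⟩, rfl⟩
        exact (congrArg D.preInclusion (h c a)).trans (N.repFunctional_projTmul c a).symm)
    exact congrArg (fun R : _ →L[ℂ] StrongDual ℂ A => R u) this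
  · intro h c a
    exact D.preInclusion.injective ((h _).trans (N.repFunctional_projTmul c a))

/-- The preimage of the closed subspace `P` under a bounded map is a closed subspace; it contains
the special tensors, hence everything. This is what makes `S_φ` take values in `P` and not merely in
the dual of `A`. -/
lemma repFunctional_mem_range (hd : DenseRange N.inclAdjoint)
    (u : ProjTensor (StrongDual ℂ N.E) N.E) :
    N.repFunctional u ∈ LinearMap.range D.preInclusion.toLinearMap := by
  have h : (Submodule.span ℂ (Set.range fun p : Matrix (Fin n) (Fin n) A × A =>
      projTmul (N.inclAdjoint p.1) (N.vec p.2))) ≤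
      (LinearMap.range D.preInclusion.toLinearMap).comap N.repFunctional.toLinearMap := by
    rw [Submodule.span_le]
    rintro _ ⟨⟨c, a⟩, rfl⟩
    exact ⟨_, (N.repFunctional_projTmul c a).symm⟩
  have hc : IsClosed ((LinearMap.range D.preInclusion.toLinearMap).comap
      N.repFunctional.toLinearMap : Set (ProjTensor (StrongDual ℂ N.E) N.E)) :=
    isClosed_range_preInclusion.preimage N.repFunctional.continuous
  exact closure_minimal h hc (dense_span_projTmul_of_denseRange hd N.denseRange_vec u)

/-- The map `S_φ`, provided that `ι_φ*` has dense range. -/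
def inducedMap (hd : DenseRange N.inclAdjoint) :
    ProjTensor (StrongDual ℂ N.E) N.E →L[ℂ] P :=
  -- The isometry of `P` onto its image is inverted, which keeps the map bounded.
  (D.preInclusion.equivRange.symm.toContinuousLinearEquiv :
      LinearMap.range D.preInclusion.toLinearMap →L[ℂ] P).comp
    (N.repFunctional.codRestrict _ (N.repFunctional_mem_range hd))

lemma preInclusion_inducedMap (hd : DenseRange N.inclAdjoint)
    (u : ProjTensor (StrongDual ℂ N.E) N.E) :
    D.preInclusion (N.inducedMap hd u) = N.repFunctional u :=
  congrArg Subtype.val (D.preInclusion.equivRange.apply_symm_apply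
    ⟨N.repFunctional u, N.repFunctional_mem_range hd u⟩)

end OrbitNorm
end CCDualBanachAlgebra

end

/-! ### Assembly of the theorem -/

theorem theorem1 {A P : Type*} [NonUnitalNormedRing A] [NormedSpace ℂ A] [IsScalarTower ℂ A A]
    [SMulCommClass ℂ A A] [OperatorSpace A] [NormedAddCommGroup P] [NormedSpace ℂ P]
    [CompleteSpace P] [OperatorSpace P] (D : CCDualBanachAlgebra A P)
    {n : ℕ} (hn : 1 ≤ n) (φ : Matrix (Fin n) (Fin n) P) (N : D.AdmissibleNorm φ) :
    ∃ S : ProjTensor (StrongDual ℂ N.E) N.E →L[ℂ] P,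
      N.IsInducedMap S ∧ (∀ S', N.IsInducedMap S' → S' = S) ∧
      ∃ T : A →ₙₐ[ℂ] CB N.E,
        (∀ (a : A) (u : ProjTensor (StrongDual ℂ N.E) N.E),
          cbPairing (T a) u = D.toDual a (S u)) ∧
        Continuous[weakStarTopology D.toDual, weakStarTopology cbPairing] T ∧
        (∀ (m : ℕ) (a : Matrix (Fin m) (Fin m) A),
          matCBNorm (a.map fun x => (T x : N.E →L[ℂ] N.E)) ≤ ENNReal.ofReal (matNorm a)) ∧
        ∀ a b : A, (T a : N.E →L[ℂ] N.E) (N.vec b) = N.vec (a * b) := by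
  have hd := N.denseRange_inclAdjoint N.reflexive N.injective
  -- The adjoint relation `T_φ = S_φ*`.
  have hS : ∀ (a : A) (u : ProjTensor (StrongDual ℂ N.E) N.E),
      cbPairing (N.rep a) u = D.toDual a (N.inducedMap hd u) := fun a u =>
    congrArg (fun l : StrongDual ℂ A => l a) (N.preInclusion_inducedMap hd u).symm
  refine ⟨N.inducedMap hd, (N.isInducedMap_iff hd _).2 (N.preInclusion_inducedMap hd),
    fun S' hS' => ContinuousLinearMap.ext fun u => D.preInclusion.injective ?_,
    N.rep, hS, ?_, fun m a => ?_, N.action_vec⟩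
  · rw [(N.isInducedMap_iff hd S').1 hS', N.preInclusion_inducedMap hd]
  -- By the adjoint relation, pairing `T_φ(a)` with `u` is evaluating `a` at the point `S_φ(u)` of
  -- the predual, which is weak-star continuous in `a`.
  · refine continuous_induced_rng.2 ?_
    let : TopologicalSpace A := weakStarTopology D.toDual
    refine continuous_pi fun u => ?_
    simp only [Function.comp_apply, hS]
    exact (continuous_apply (N.inducedMap hd u)).comp continuous_induced_dom
  · exact (matCBNorm_le_iff _ _ (matNorm_nonneg a)).2
      fun k x => N.matNorm_bilinAmp_action_le a x
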